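/- **Conventions.** All categories are small. $\mathrm{StrMonCat}$ is the category of strict monoidal categories and strict monoidal functors. For a strict monoidal category $\mathscr M$, $\mathscr{BM}$ is the 2-category with one object, with the objects of $\mathscr M$ as 1-cells, the morphisms of $\mathscr M$ as 2-cells, and composition $g\circ f=g\otimes f$. For a 2-category $\mathscr C$, the (Duskin) nerve $\mathscr{NC}$ is the simplicial set whose $n$-simplices are the normalised (strictly unitary) lax functors $[n]\to\mathscr C$; thus an $n$-simplex of $\mathscr{NBM}$ consists of objects $f_{ij}$ of $\mathscr M$ and morphisms $\alpha_{ijk}\colon f_{jk}\otimes f_{ij}\to f_{ik}$, normalised and compatible on every $i\le j\le k\le l$. $\mathrm{sSet}_{\le 3}$ is the category of presheaves on the full subcategory $\Delta_{\le 3}\subset\Delta$ on $[0],\dots,[3]$, $\mathrm{tr}_3\colon\mathrm{sSet}\to\mathrm{sSet}_{\le3}$ is restriction, and $y\colon \Delta_{\le 3}\to\mathrm{sSet}_{\le 3}$ is the Yoneda embedding. A simplicial set is *3-coskeletal* if it is the right Kan extension of its restriction to $\Delta_{\le3}^{\mathrm{op}}$. Put $$\Psi\colon \mathrm{StrMonCat}\to\mathrm{sSet}_{\le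 3},\qquad \Psi\mathscr M=\mathrm{tr}_3\,\mathscr{NBM}.$$ A *unary operadic 2-category* $\mathbb O=(X,\mathscr C)$ is a simplicial set $X$ with a 2-category $\mathscr C$ and an isomorphism $\mathrm{dec}_\top X\cong\mathscr{NC}$, where $\mathrm{dec}_\top X$ is the upper décalage: $(\mathrm{dec}_\top X)_n=X_{n+1}$, with the top face and degeneracy maps forgotten. A morphism $(X,\mathscr C)\to(Y,\mathscr D)$ in the category $\mathrm{uOpCat}$ is a simplicial map $X\to Y$. The functor $\int_\odot\colon\mathrm{StrMonCat}\to\mathrm{uOpCat}$ (the operadic Grothendieck construction over the terminal unary operadic 2-category $\odot$) sends $\mathscr M$ to $(\mathscr{NBM},\mathscr{DBM})$. Here $\mathscr{DBM}$ is the 2-category whose objects are the objects of $\mathscr M$, whose 1-cells $x\to y$ are pairs $(a,\ y\otimes a\to x)$, and whose 2-cells $(a,f)\to(b,g)$ are the morphisms $\theta\colon a\to b$ with $g(\mathrm{id}_y\otimes\theta)=f$; the identification $\mathrm{dec}_\top\mathscr{NBM}\cong\mathscr{N}\mathscr{DBM}$ is the canonical one. For $0\le n\le 3$ let $\Phi_0[n]$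 be the following strict monoidal category. Its objects are the finite lists of symbols $f_{ij}$ with $0\le i<j\le n$. The *generating multimorphisms* are the identities $f_{ij}\to f_{ij}$, one $\alpha_{ijk}\colon (f_{jk},f_{ij})\to f_{ik}$ for all $0\le i<j<k\le n$, and, if $n=3$, one $\sigma_{0123}\colon(f_{23},f_{12},f_{01})\to f_{03}$. A morphism $(a_1,\dots,a_k)\to(b_1,\dots,b_l)$ is a tuple $(g_1,\dots,g_l)$ of generating multimorphisms such that $g_r$ has target $b_r$ and the sources of $g_1,\dots,g_l$ concatenate to $(a_1,\dots,a_k)$; there is at most one such tuple, which determines composition, and in particular $$\alpha_{013}\circ(\alpha_{123},\mathrm{id}_{f_{01}})=\sigma_{0123}=\alpha_{023}\circ(\mathrm{id}_{f_{23}},\alpha_{012}).$$ The monoidal product is concatenation and the unit is the empty list. A monotone map $\theta\colon[n]\to[m]$ induces the strict monoidal functor $\Phi_0\theta\colon\Phi_0[n]\to\Phi_0[m]$ with $f_{ij}\mapsto f_{\theta(i)\theta(j)}$ (the empty list if $\theta(i)=\theta(j)$); this makes $\Phi_0$ a functor $\Delta_{\le 3}\to\mathrm{StrMonCat}$. Let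 $\sigma_n\in(\Psi\Phi_0[n])_n$ be the simplex with edges $f_{ij}$ and 2-simplices $\alpha_{ijk}$ (and identities where indices coincide). **Theorem.** 1. For every $n\in\{0,1,2,3\}$ and every strict monoidal category $\mathscr M$, the map $F\mapsto\Psi(F)(\sigma_n)$ is a bijection $$\mathrm{StrMonCat}(\Phi_0[n],\mathscr M)\;\cong\;(\Psi\mathscr M)_n .$$ 2. For every $\theta\colon[n]\to[m]$ in $\Delta_{\le 3}$, $\Psi(\Phi_0\theta)(\sigma_n)=\theta^*\sigma_m$. 3. For every strict monoidal category $\mathscr M$, the nerve $\mathscr{NBM}$ is 3-coskeletal. 4. The left Kan extension $\Phi=\mathrm{Lan}_y\Phi_0\colon\mathrm{sSet}_{\le3}\to\mathrm{StrMonCat}$ of $\Phi_0$ along $y$ exists and is left adjoint to $\Psi$. Moreover $\Phi\circ\mathrm{tr}_3\colon\mathrm{sSet}\to\mathrm{StrMonCat}$ is left adjoint to $\mathscr M\mapsto\mathscr{NBM}$, and the functor $\mathrm{uOpCat}\to\mathrm{StrMonCat}$, $(X,\mathscr C)\mapsto\Phi\,\mathrm{tr}_3X$, is left adjoint to $\int_\odot$.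 -/

import Mathlib

open CategoryTheory

universe u v w

namespace UnaryOperadic

/-! ## Strict monoidal categories -/

section Strict

open MonoidalCategory

/-- A monoidal category is strict if its associators and unitors are identities. -/
class StrictMonoidal (M : Type u) [Category.{v} M] [MonoidalCategory M] : Prop where
  unit_tensor : ∀ x : M, 𝟙_ M ⊗ x = x
  tensor_unit : ∀ x : M, x ⊗ 𝟙_ M = x
  tensor_assoc : ∀ x y z : M, (x ⊗ y) ⊗ z = x ⊗ (y ⊗ z)
  leftUnitor_eq : ∀ x : M, λ_ x = eqToIso (unit_tensor x)
  rightUnitor_eq : ∀ x : M, ρ_ x = eqToIso (tensor_unit x)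
  associator_eq : ∀ x y z : M, α_ x y z = eqToIso (tensor_assoc x y z)

/-- A strict monoidal functor: a functor that preserves the unit and the tensor product
(of objects and of morphisms) on the nose. -/
structure StrictMonoidalFunctor (M : Type u) [Category.{v} M] [MonoidalCategory M]
    (N : Type u) [Category.{v} N] [MonoidalCategory N] extends M ⥤ N where
  obj_unit : obj (𝟙_ M) = 𝟙_ N
  obj_tensor : ∀ x y : M, obj (x ⊗ y) = obj x ⊗ obj y
  map_tensor : ∀ {x x' y y' : M} (f : x ⟶ x') (g : y ⟶ y'),
    map (f ⊗ₘ g) = eqToHom (obj_tensor x y) ≫ (map f ⊗ₘ map g) ≫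
      eqToHom (obj_tensor x' y').symm

namespace StrictMonoidalFunctor

variable {M : Type u} [Category.{v} M] [MonoidalCategory M]
  {N : Type u} [Category.{v} N] [MonoidalCategory N]
  {P : Type u} [Category.{v} P] [MonoidalCategory P]

theorem ext_functor {F G : StrictMonoidalFunctor M N} (h : F.toFunctor = G.toFunctor) :
    F = G := by
  cases F; cases G; cases h; rfl

/-- The identity strict monoidal functor. -/
def id (M : Type u) [Category.{v} M] [MonoidalCategory M] : StrictMonoidalFunctor M M where
  toFunctor := 𝟭 M
  obj_unit := rfl
  obj_tensor _ _ := rfl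
  map_tensor _ _ := by simp

theorem eqToHom_tensor {x x' y y' : N} (h : x = x') (k : y = y') :
    (eqToHom h ⊗ₘ eqToHom k) = eqToHom (by rw [h, k]) := by
  cases h; cases k; simp

/-- The composition of strict monoidal functors. -/
def comp (F : StrictMonoidalFunctor M N) (G : StrictMonoidalFunctor N P) :
    StrictMonoidalFunctor M P where
  toFunctor := F.toFunctor ⋙ G.toFunctor
  obj_unit := by simp [F.obj_unit, G.obj_unit]
  obj_tensor x y := by simp [F.obj_tensor, G.obj_tensor]
  map_tensor f g := by simp [F.map_tensor, G.map_tensor, eqToHom_map]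

end StrictMonoidalFunctor

/-- A small strict monoidal category. -/
structure StrMonCat : Type (u + 1) where
  carrier : Type u
  [category : Category.{u} carrier]
  [monoidal : MonoidalCategory carrier]
  [strict : StrictMonoidal carrier]

attribute [instance] StrMonCat.category StrMonCat.monoidal StrMonCat.strict

/-- The category of small strict monoidal categories and strict monoidal functors. -/
instance : Category.{u} StrMonCat.{u} where
  Hom M N := StrictMonoidalFunctor M.carrier N.carrier
  id M := StrictMonoidalFunctor.id M.carrier
  comp F G := F.comp G
  id_comp _ := rfl
  comp_id _ := rfl
  assoc _ _ _ := rfl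

end Strict

/-! ## The one-object 2-category of a strict monoidal category -/

section Deloop

open MonoidalCategory

/-- The one-object bicategory `BM`: its 1-cells are the objects of `M`, its 2-cells the morphisms
of `M`, and the composite `g ∘ f` of 1-cells (written `f ≫ g` in diagrammatic order) is
`g ⊗ f`. -/
structure Deloop (M : Type u) : Type u where

instance (M : Type u) [Category.{v} M] [MonoidalCategory M] : Bicategory.{v, u} (Deloop M) where
  Hom _ _ := M
  id _ := 𝟙_ M
  comp f g := g ⊗ f
  homCategory _ _ := inferInstanceAs (Category M)
  whiskerLeft f _ _ η := η ▷ f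
  whiskerRight η h := h ◁ η
  associator f g h := (α_ h g f).symm
  leftUnitor f := ρ_ f
  rightUnitor f := λ_ f
  whisker_exchange η θ := (MonoidalCategory.whisker_exchange θ η).symm

instance (M : Type u) [Category.{v} M] [MonoidalCategory M] [StrictMonoidal M] :
    Bicategory.Strict (Deloop M) where
  id_comp f := StrictMonoidal.tensor_unit (M := M) f
  comp_id f := StrictMonoidal.unit_tensor (M := M) f
  assoc f g h := (StrictMonoidal.tensor_assoc (M := M) h g f).symm
  leftUnitor_eqToIso f := StrictMonoidal.rightUnitor_eq (M := M) f
  rightUnitor_eqToIso f := StrictMonoidal.leftUnitor_eq (M := M) f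
  associator_eqToIso f g h :=
    (congrArg Iso.symm (StrictMonoidal.associator_eq (M := M) h g f)).trans (by rfl)

variable {M : Type u} [Category.{v} M] [MonoidalCategory M]
  {N : Type u} [Category.{v} N] [MonoidalCategory N]

/-- The strict 2-functor `BF : BM ⥤ BN` of a strict monoidal functor `F : M ⥤ N`. -/
def StrictMonoidalFunctor.deloop [StrictMonoidal M] [StrictMonoidal N]
    (F : StrictMonoidalFunctor M N) : StrictPseudofunctor (Deloop M) (Deloop N) :=
  StrictPseudofunctor.mk''
    { obj := fun _ => ⟨⟩
      map := fun {_ _} (x : M) => F.obj x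
      map₂ := fun {_ _} {x y : M} (f : x ⟶ y) => F.map f
      map₂_id := fun {_ _} (x : M) => F.map_id x
      map₂_comp := fun {_ _} {x y z : M} (f : x ⟶ y) (g : y ⟶ z) => F.map_comp f g
      map_id := fun _ => F.obj_unit
      map_comp := fun {_ _ _} (x y : M) => F.obj_tensor y x
      map₂_whisker_left := fun {_ _ _} (x : M) {y z : M} (f : y ⟶ z) => by
        have := F.map_tensor f (𝟙 x)
        rw [F.map_id, tensorHom_id, tensorHom_id] at this
        exact this
      map₂_whisker_right := fun {_ _ _} {y z : M} (f : y ⟶ z) (x : M) => by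
        have := F.map_tensor (𝟙 x) f
        rw [F.map_id, id_tensorHom, id_tensorHom] at this
        exact this }

end Deloop

/-! ## The Duskin nerve -/

section Nerve

open Bicategory Opposite

/-- A monotone map, as a strict 2-functor between ordinals regarded as 2-categories with only
identity 2-cells. -/
def ordMap {I J : Type w} [Preorder I] [Preorder J] (f : I →o J) :
    StrictPseudofunctor (LocallyDiscrete I) (LocallyDiscrete J) :=
  StrictPseudofunctor.mk''
    { obj := fun i => ⟨f i.as⟩
      map := fun g => ⟨f.monotone.functor.map g.as⟩
      map₂ := fun η => eqToHom (by rw [LocallyDiscrete.eq_of_hom η])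
      map_id := fun _ => rfl
      map_comp := fun _ _ => rfl }

/-- A strict 2-functor, regarded as a normalised lax functor. -/
abbrev toNLax {B : Type*} [Bicategory B] {C : Type*} [Bicategory C]
    (F : StrictPseudofunctor B C) : StrictlyUnitaryLaxFunctor B C :=
  F.toStrictlyUnitaryPseudofunctor.toStrictlyUnitaryLaxFunctor

theorem nlax_ext {B : Type*} [Bicategory B] {C : Type*} [Bicategory C]
    {F G : StrictlyUnitaryLaxFunctor B C} (h : F.toLaxFunctor = G.toLaxFunctor) : F = G := by
  cases F; cases G; cases h; rfl

theorem ordMap_id (I : Type w) [Preorder I] :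
    toNLax (ordMap (OrderHom.id : I →o I)) = StrictlyUnitaryLaxFunctor.id _ := by
  rfl

theorem ordMap_comp {I J K : Type w} [Preorder I] [Preorder J] [Preorder K] (f : I →o J)
    (g : J →o K) :
    toNLax (ordMap (g.comp f)) =
      (toNLax (ordMap f)).comp (toNLax (ordMap g)) := by
  rfl

/-- The Duskin nerve of a 2-category `C`: an `n`-simplex is a normalised (that is, strictly
unitary) lax functor from the ordinal `0 < 1 < ⋯ < n` to `C`. -/
def duskinNerve (C : Type u) [Bicategory.{u, u} C] : SSet.{u} where
  obj n := StrictlyUnitaryLaxFunctor (LocallyDiscrete (Fin (n.unop.len + 1))) C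
  map f := TypeCat.ofHom fun σ => (toNLax (ordMap f.unop.toOrderHom)).comp σ
  map_id n := by
    ext σ
    exact StrictlyUnitaryLaxFunctor.id_comp σ
  map_comp f g := by
    ext σ
    exact (congrArg (fun F => StrictlyUnitaryLaxFunctor.comp F σ)
      (ordMap_comp g.unop.toOrderHom f.unop.toOrderHom)).trans
      (StrictlyUnitaryLaxFunctor.comp_assoc _ _ σ)

/-- The map of nerves induced by a normalised lax functor. -/
def duskinNerveMap {C : Type u} [Bicategory.{u, u} C] {D : Type u} [Bicategory.{u, u} D]
    (F : StrictlyUnitaryLaxFunctor C D) : duskinNerve C ⟶ duskinNerve D where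
  app n := TypeCat.ofHom fun σ => StrictlyUnitaryLaxFunctor.comp σ F
  naturality f g := by
    intros
    ext σ
    exact (StrictlyUnitaryLaxFunctor.comp_assoc _ σ F)

end Nerve

/-! ## Upper décalage and unary operadic 2-categories -/

section UOpCat

open Opposite

/-- The extension of a monotone map `[n] → [m]` to `[n+1] → [m+1]` that preserves the top. -/
def topExtend {n m : ℕ} (f : Fin n →o Fin m) : Fin (n + 1) →o Fin (m + 1) where
  toFun := Fin.lastCases (motive := fun _ => Fin (m + 1)) (Fin.last m) (fun i => (f i).castSucc)
  monotone' := by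
    intro i j h
    induction j using Fin.lastCases with
    | last => simpa using Fin.le_last _
    | cast j =>
      induction i using Fin.lastCases with
      | last => exact absurd h (by simp [Fin.le_def])
      | cast i => simpa using f.monotone (by simpa using h)

@[simp]
theorem topExtend_last {n m : ℕ} (f : Fin n →o Fin m) :
    topExtend f (Fin.last n) = Fin.last m :=
  Fin.lastCases_last (motive := fun _ => Fin (m + 1)) (last := Fin.last m)
    (cast := fun i => (f i).castSucc)

@[simp]
theorem topExtend_castSucc {n m : ℕ} (f : Fin n →o Fin m) (i : Fin n) :
    topExtend f i.castSucc = (f i).castSucc :=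
  Fin.lastCases_castSucc (motive := fun _ => Fin (m + 1)) (last := Fin.last m)
    (cast := fun i => (f i).castSucc) i

theorem topExtend_id {n : ℕ} (i : Fin (n + 1)) :
    topExtend (OrderHom.id : Fin n →o Fin n) i = i := by
  induction i using Fin.lastCases <;> simp

theorem topExtend_comp {n m k : ℕ} (f : Fin n →o Fin m) (g : Fin m →o Fin k) (i : Fin (n + 1)) :
    topExtend (g.comp f) i = topExtend g (topExtend f i) := by
  induction i using Fin.lastCases <;> simp

/-- The functor `[n] ↦ [n+1]` that adds a new top element to ordinals and extends monotone maps so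
as to preserve it. -/
def addTop : SimplexCategory ⥤ SimplexCategory where
  obj n := SimplexCategory.mk (n.len + 1)
  map f := SimplexCategory.Hom.mk (topExtend f.toOrderHom)
  map_id n := by
    ext i : 3
    exact topExtend_id i
  map_comp {n m k} f g := by
    ext i : 3
    exact topExtend_comp f.toOrderHom g.toOrderHom i

/-- The upper décalage: `(dec X)_n = X_{n+1}`, forgetting the top face and degeneracy maps. -/
def dec (X : SSet.{u}) : SSet.{u} := addTop.op ⋙ X

/-- A unary operadic 2-category: a simplicial set `X` and a (strict, small) 2-category `C`
together with an isomorphism between the upper décalage of `X` and the nerve of `C`. -/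
structure UnaryOperadicTwoCat : Type (u + 1) where
  X : SSet.{u}
  C : Type u
  [bicategory : Bicategory.{u, u} C]
  [strict : Bicategory.Strict C]
  iso : dec X ≅ duskinNerve C

/-- The category of unary operadic 2-categories. Operadic functors are the maps of underlying
simplicial sets. -/
abbrev UOpCat : Type (u + 1) := InducedCategory SSet.{u} UnaryOperadicTwoCat.X

/-- The functor that takes a unary operadic 2-category `(X, C)` to `X`. -/
abbrev UOpCat.toSSet : UOpCat.{u} ⥤ SSet.{u} := inducedFunctor UnaryOperadicTwoCat.X

end UOpCat

/-! ## The lax slice 2-category of `BM` -/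

section Para

open MonoidalCategory

/-- The objects of the lax slice 2-category `Para M = D(BM)`: the objects of `M`. -/
@[ext]
structure Para (M : Type u) : Type u where
  obj : M

variable {M : Type u} [Category.{v} M] [MonoidalCategory M]

/-- A 1-cell `x ⟶ y` of `Para M` is an object `a` with a morphism `y ⊗ a ⟶ x`. -/
structure ParaHom (x y : Para M) : Type (max u v) where
  a : M
  map : y.obj ⊗ a ⟶ x.obj

/-- A 2-cell `(a, f) ⟶ (b, g)` of `Para M` is a morphism `a ⟶ b` compatible with `f`, `g`. -/
@[ext]
structure ParaHom₂ {x y : Para M} (f g : ParaHom x y) : Type v where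
  hom : f.a ⟶ g.a
  w : y.obj ◁ hom ≫ g.map = f.map

attribute [simp] ParaHom₂.w

@[simps]
instance paraHomCategory (x y : Para M) : Category (ParaHom x y) where
  Hom f g := ParaHom₂ f g
  id f := ⟨𝟙 _, by simp⟩
  comp η θ := ⟨η.hom ≫ θ.hom, by simp⟩

@[ext]
theorem paraHom₂_ext {x y : Para M} {f g : ParaHom x y} {η θ : f ⟶ g} (h : η.hom = θ.hom) :
    η = θ := ParaHom₂.ext h

/-- The identity 1-cell `(𝟙, x ⊗ 𝟙 ⟶ x)`. -/
@[simps]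
def ParaHom.id (x : Para M) : ParaHom x x := ⟨𝟙_ M, (ρ_ x.obj).hom⟩

/-- The composite of `(a, f) : x ⟶ y` and `(b, g) : y ⟶ z` is
`(b ⊗ a, z ⊗ b ⊗ a ⟶ y ⊗ a ⟶ x)`. -/
@[simps]
def ParaHom.comp {x y z : Para M} (f : ParaHom x y) (g : ParaHom y z) : ParaHom x z :=
  ⟨g.a ⊗ f.a, (α_ _ _ _).inv ≫ g.map ▷ f.a ≫ f.map⟩

/-- An invertible 2-cell of `Para M`. -/
@[simps]
def paraIso {x y : Para M} {f g : ParaHom x y} (e : f.a ≅ g.a)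
    (w : y.obj ◁ e.hom ≫ g.map = f.map) : f ≅ g where
  hom := ⟨e.hom, w⟩
  inv := ⟨e.inv, by simp [← w]⟩

theorem para_whiskerLeft {x y z a b c : M} (η : b ⟶ c) (f : y ⊗ a ⟶ x) (g : z ⊗ b ⟶ y)
    (h : z ⊗ c ⟶ y) (w : z ◁ η ≫ h = g) :
    z ◁ (η ▷ a) ≫ (α_ z c a).inv ≫ h ▷ a ≫ f = (α_ z b a).inv ≫ g ▷ a ≫ f := by
  simp [← w]

theorem para_whiskerRight {x y z a b c : M} (η : a ⟶ b) (f : y ⊗ a ⟶ x) (g : y ⊗ b ⟶ x)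
    (h : z ⊗ c ⟶ y) (w : y ◁ η ≫ g = f) :
    z ◁ (c ◁ η) ≫ (α_ z c b).inv ≫ h ▷ b ≫ g = (α_ z c a).inv ≫ h ▷ a ≫ f := by
  subst w
  simp only [associator_inv_naturality_right_assoc,
    whisker_exchange_assoc]

theorem para_assoc {x y z t a b c : M} (f : y ⊗ a ⟶ x) (g : z ⊗ b ⟶ y) (h : t ⊗ c ⟶ z) :
    t ◁ (α_ c b a).inv ≫ (α_ t (c ⊗ b) a).inv ≫ ((α_ t c b).inv ≫ h ▷ b ≫ g) ▷ a ≫ f =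
      (α_ t c (b ⊗ a)).inv ≫ h ▷ (b ⊗ a) ≫ (α_ z b a).inv ≫ g ▷ a ≫ f := by
  simp

theorem para_leftUnitor {x y a : M} (f : y ⊗ a ⟶ x) :
    y ◁ (ρ_ a).hom ≫ f = (α_ y a (𝟙_ M)).inv ≫ f ▷ 𝟙_ M ≫ (ρ_ x).hom := by
  simp

theorem para_rightUnitor {x y a : M} (f : y ⊗ a ⟶ x) :
    y ◁ (λ_ a).hom ≫ f = (α_ y (𝟙_ M) a).inv ≫ (ρ_ y).hom ▷ a ≫ f := by
  simp

instance : Bicategory.{v, max u v} (Para M) where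
  Hom x y := ParaHom x y
  id x := ParaHom.id x
  comp f g := ParaHom.comp f g
  homCategory x y := paraHomCategory x y
  whiskerLeft f g h η := ⟨η.hom ▷ f.a, para_whiskerLeft η.hom f.map g.map h.map η.w⟩
  whiskerRight {_ _ _ f g} η h := ⟨h.a ◁ η.hom, para_whiskerRight η.hom f.map g.map h.map η.w⟩
  associator f g h := paraIso (α_ h.a g.a f.a).symm (para_assoc f.map g.map h.map)
  leftUnitor f := paraIso (ρ_ f.a) (para_leftUnitor f.map)
  rightUnitor f := paraIso (λ_ f.a) (para_rightUnitor f.map)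
  whiskerLeft_id f g := paraHom₂_ext (Bicategory.whiskerLeft_id (B := Deloop M)
    (a := ⟨⟩) (b := ⟨⟩) (c := ⟨⟩) f.a g.a)
  whiskerLeft_comp {_ _ _} f {_ _ _} η θ := paraHom₂_ext (Bicategory.whiskerLeft_comp (B := Deloop M)
    (a := ⟨⟩) (b := ⟨⟩) (c := ⟨⟩) f.a η.hom θ.hom)
  id_whiskerLeft η := paraHom₂_ext (Bicategory.id_whiskerLeft (B := Deloop M)
    (a := ⟨⟩) (b := ⟨⟩) η.hom)
  comp_whiskerLeft {_ _ _ _} f g {_ _} η := paraHom₂_ext (Bicategory.comp_whiskerLeft (B := Deloop M)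
    (a := ⟨⟩) (b := ⟨⟩) (c := ⟨⟩) (d := ⟨⟩) f.a g.a η.hom)
  id_whiskerRight f g := paraHom₂_ext (Bicategory.id_whiskerRight (B := Deloop M)
    (a := ⟨⟩) (b := ⟨⟩) (c := ⟨⟩) f.a g.a)
  comp_whiskerRight η θ g := paraHom₂_ext (Bicategory.comp_whiskerRight (B := Deloop M)
    (a := ⟨⟩) (b := ⟨⟩) (c := ⟨⟩) η.hom θ.hom g.a)
  whiskerRight_id η := paraHom₂_ext (Bicategory.whiskerRight_id (B := Deloop M)
    (a := ⟨⟩) (b := ⟨⟩) η.hom)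
  whiskerRight_comp η g h := paraHom₂_ext (Bicategory.whiskerRight_comp (B := Deloop M)
    (a := ⟨⟩) (b := ⟨⟩) (c := ⟨⟩) (d := ⟨⟩) η.hom g.a h.a)
  whisker_assoc {_ _ _ _} f {_ _} η h := paraHom₂_ext (Bicategory.whisker_assoc (B := Deloop M)
    (a := ⟨⟩) (b := ⟨⟩) (c := ⟨⟩) (d := ⟨⟩) f.a η.hom h.a)
  whisker_exchange η θ := paraHom₂_ext (Bicategory.whisker_exchange (B := Deloop M)
    (a := ⟨⟩) (b := ⟨⟩) (c := ⟨⟩) η.hom θ.hom)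
  pentagon f g h i := paraHom₂_ext (Bicategory.pentagon (B := Deloop M)
    (a := ⟨⟩) (b := ⟨⟩) (c := ⟨⟩) (d := ⟨⟩) (e := ⟨⟩) f.a g.a h.a i.a)
  triangle f g := paraHom₂_ext (Bicategory.triangle (B := Deloop M)
    (a := ⟨⟩) (b := ⟨⟩) (c := ⟨⟩) f.a g.a)

theorem paraHom_ext {x y : Para M} {f g : ParaHom x y} (h : f.a = g.a)
    (w : y.obj ◁ eqToHom h ≫ g.map = f.map) : f = g := by
  obtain ⟨a, f⟩ := f
  obtain ⟨b, g⟩ := g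
  cases h
  obtain rfl : g = f := by simpa using w
  rfl

theorem para_eqToHom_hom {x y : Para M} {f g : ParaHom x y} (h : f = g) :
    (eqToHom h).hom = eqToHom (congrArg ParaHom.a h) := by
  cases h; rfl

theorem paraHom_id_comp [StrictMonoidal M] {x y : Para M} (f : ParaHom x y) :
    (ParaHom.id x).comp f = f :=
  paraHom_ext (StrictMonoidal.tensor_unit f.a) (by
    have h := para_leftUnitor f.map
    rw [StrictMonoidal.rightUnitor_eq f.a] at h
    exact h)

theorem paraHom_comp_id [StrictMonoidal M] {x y : Para M} (f : ParaHom x y) :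
    f.comp (ParaHom.id y) = f :=
  paraHom_ext (StrictMonoidal.unit_tensor f.a) (by
    have h := para_rightUnitor f.map
    rw [StrictMonoidal.leftUnitor_eq f.a] at h
    exact h)

theorem paraHom_assoc [StrictMonoidal M] {x y z t : Para M} (f : ParaHom x y) (g : ParaHom y z)
    (h : ParaHom z t) : (f.comp g).comp h = f.comp (g.comp h) :=
  paraHom_ext (StrictMonoidal.tensor_assoc h.a g.a f.a).symm (by
    have w := para_assoc f.map g.map h.map
    rw [StrictMonoidal.associator_eq h.a g.a f.a] at w
    exact w)

instance [StrictMonoidal M] : Bicategory.Strict (Para M) where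
  id_comp {x y} f := paraHom_id_comp (x := x) (y := y) f
  comp_id {x y} f := paraHom_comp_id (x := x) (y := y) f
  assoc {x y z t} f g h := paraHom_assoc (x := x) (y := y) (z := z) (t := t) f g h
  leftUnitor_eqToIso f := by
    apply Iso.ext
    apply paraHom₂_ext
    refine Eq.trans ?_ (para_eqToHom_hom (paraHom_id_comp f)).symm
    exact congrArg Iso.hom (StrictMonoidal.rightUnitor_eq f.a)
  rightUnitor_eqToIso f := by
    apply Iso.ext
    apply paraHom₂_ext
    refine Eq.trans ?_ (para_eqToHom_hom (paraHom_comp_id f)).symm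
    exact congrArg Iso.hom (StrictMonoidal.leftUnitor_eq f.a)
  associator_eqToIso f g h := by
    apply Iso.ext
    apply paraHom₂_ext
    refine Eq.trans ?_ (para_eqToHom_hom (paraHom_assoc f g h)).symm
    exact congrArg Iso.inv (StrictMonoidal.associator_eq h.a g.a f.a)

end Para

/-! ## The isomorphism between the décalage of the nerve of `BM` and the nerve of `Para M` -/

section DecNerve

open Bicategory Opposite

theorem nlax_ext' {B : Type*} [Bicategory B] {C : Type*} [Bicategory C]
    {F G : StrictlyUnitaryLaxFunctor B C} (h : F.toPrefunctor = G.toPrefunctor)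
    (h₂ : HEq (@F.map₂) (@G.map₂)) (h₀ : HEq F.mapId G.mapId) (hc : HEq (@F.mapComp) (@G.mapComp)) :
    F = G := by
  obtain ⟨⟨⟨⟨p, m₂⟩, _, _⟩, m₀, c, _, _, _, _, _⟩, _, _⟩ := F
  obtain ⟨⟨⟨⟨q, n₂⟩, _, _⟩, n₀, d, _, _, _, _, _⟩, _, _⟩ := G
  dsimp at h h₂ h₀ hc
  cases h
  cases h₂
  cases h₀
  cases hc
  rfl

/-- The data of a normalised lax functor from a preorder `I` to a bicategory `C`, spelled out. -/
structure LaxSimplex (I : Type) [Preorder I] (C : Type u) [Bicategory.{w, v} C] where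
  obj : I → C
  map : ∀ {i j : I}, i ≤ j → (obj i ⟶ obj j)
  comp : ∀ {i j k : I} (h : i ≤ j) (h' : j ≤ k), map h ≫ map h' ⟶ map (h.trans h')
  map_id : ∀ i : I, map (le_refl i) = 𝟙 (obj i)
  id_left : ∀ {i j : I} (h : i ≤ j),
    comp (le_refl i) h = eqToHom (by rw [map_id]) ≫ (λ_ (map h)).hom
  id_right : ∀ {i j : I} (h : i ≤ j),
    comp h (le_refl j) = eqToHom (by rw [map_id]) ≫ (ρ_ (map h)).hom
  assoc : ∀ {i j k l : I} (h : i ≤ j) (h' : j ≤ k) (h'' : k ≤ l),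
    comp h h' ▷ map h'' ≫ comp (h.trans h') h'' =
      (α_ (map h) (map h') (map h'')).hom ≫ map h ◁ comp h' h'' ≫ comp h (h'.trans h'')

namespace LaxSimplex

theorem ext' {I : Type} [Preorder I] {C : Type u} [Bicategory.{w, v} C] {F G : LaxSimplex I C}
    (h₀ : F.obj = G.obj) (h₁ : HEq (@F.map) (@G.map)) (h₂ : HEq (@F.comp) (@G.comp)) : F = G := by
  obtain ⟨o, m, c, _, _, _, _⟩ := F
  obtain ⟨o', m', c', _, _, _, _⟩ := G
  dsimp at h₀ h₁ h₂
  cases h₀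
  cases h₁
  cases h₂
  rfl

variable {I J : Type} [Preorder I] [Preorder J] {C : Type u} [Bicategory.{w, v} C]

/-- The normalised lax functor with given data. -/
def toNLax (S : LaxSimplex I C) : StrictlyUnitaryLaxFunctor (LocallyDiscrete I) C :=
  StrictlyUnitaryLaxFunctor.mk'
    { obj := fun i => S.obj i.as
      map := fun f => S.map (leOfHom f.as)
      map_id := fun i => S.map_id i.as
      map₂ := fun {_ _ f _} _ => 𝟙 (S.map (leOfHom f.as))
      map₂_id := fun _ => rfl
      map₂_comp := fun _ _ => (Category.id_comp _).symm
      mapComp := fun f g => S.comp (leOfHom f.as) (leOfHom g.as)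
      mapComp_naturality_left := fun {_ _ _ f f'} η g => by
        obtain rfl : f = f' := LocallyDiscrete.eq_of_hom η
        simp
      mapComp_naturality_right := fun {_ _ _} f {g g'} η => by
        obtain rfl : g = g' := LocallyDiscrete.eq_of_hom η
        simp
      map₂_leftUnitor := fun {i _} f => by
        have := S.id_left (leOfHom f.as)
        refine Eq.trans ?_ (congrArg (fun t => (λ_ (S.map (leOfHom f.as))).inv ≫
          eqToHom (by rw [S.map_id i.as]) ≫ t) this.symm)
        simp
      map₂_rightUnitor := fun {_ j} f => by
        have := S.id_right (leOfHom f.as)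
        refine Eq.trans ?_ (congrArg (fun t => (ρ_ (S.map (leOfHom f.as))).inv ≫
          eqToHom (by rw [S.map_id j.as]) ≫ t) this.symm)
        simp
      map₂_associator := fun f g h => by
        have := S.assoc (leOfHom f.as) (leOfHom g.as) (leOfHom h.as)
        refine Eq.trans ?_ this
        exact congrArg _ (Category.comp_id _) }

theorem map₂_eq (F : StrictlyUnitaryLaxFunctor (LocallyDiscrete I) C) {a b : LocallyDiscrete I}
    {f g : a ⟶ b} (η : f ⟶ g) :
    F.map₂ η = eqToHom (by rw [LocallyDiscrete.eq_of_hom η]) := by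
  obtain rfl : f = g := LocallyDiscrete.eq_of_hom η
  obtain rfl : η = 𝟙 f := Subsingleton.elim _ _
  simp

/-- The data of a normalised lax functor. -/
def ofNLax (F : StrictlyUnitaryLaxFunctor (LocallyDiscrete I) C) : LaxSimplex I C where
  obj i := F.obj ⟨i⟩
  map h := F.map ⟨homOfLE h⟩
  comp h h' := F.mapComp (a := ⟨_⟩) (b := ⟨_⟩) (c := ⟨_⟩) ⟨homOfLE h⟩ ⟨homOfLE h'⟩
  map_id i := F.map_id ⟨i⟩
  id_left {i j} h := by
    have := F.map₂_leftUnitor_hom (a := ⟨i⟩) (b := ⟨j⟩) ⟨homOfLE h⟩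
    rw [this, map₂_eq, F.mapId_eq_eqToHom, eqToHom_whiskerRight]
    simp
    rfl
  id_right {i j} h := by
    have := F.map₂_rightUnitor_hom (a := ⟨i⟩) (b := ⟨j⟩) ⟨homOfLE h⟩
    rw [this, map₂_eq, F.mapId_eq_eqToHom, whiskerLeft_eqToHom]
    simp
    rfl
  assoc {i j k l} h h' h'' := by
    have := F.map₂_associator (a := ⟨i⟩) (b := ⟨j⟩) (c := ⟨k⟩) (d := ⟨l⟩) ⟨homOfLE h⟩
      ⟨homOfLE h'⟩ ⟨homOfLE h''⟩
    rw [map₂_eq] at this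
    refine Eq.trans ?_ this
    exact congrArg _ (Category.comp_id _).symm

/-- Normalised lax functors from a preorder are the same as their data. -/
def equivNLax : StrictlyUnitaryLaxFunctor (LocallyDiscrete I) C ≃ LaxSimplex I C where
  toFun := ofNLax
  invFun := toNLax
  left_inv F := by
    have h₂ : @(toNLax (ofNLax F)).map₂ = @F.map₂ := by
      funext a b f g η
      rw [map₂_eq F η]
      obtain rfl : f = g := LocallyDiscrete.eq_of_hom η
      rfl
    have h₀ : (toNLax (ofNLax F)).mapId = F.mapId := by
      funext a
      rw [F.mapId_eq_eqToHom]
      rfl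
    exact nlax_ext' rfl (heq_of_eq h₂) (heq_of_eq h₀) HEq.rfl
  right_inv S := rfl

/-- Restriction along a monotone map. -/
def restrict (f : I →o J) (S : LaxSimplex J C) : LaxSimplex I C where
  obj i := S.obj (f i)
  map h := S.map (f.monotone h)
  comp h h' := S.comp (f.monotone h) (f.monotone h')
  map_id i := S.map_id (f i)
  id_left h := S.id_left (f.monotone h)
  id_right h := S.id_right (f.monotone h)
  assoc h h' h'' := S.assoc (f.monotone h) (f.monotone h') (f.monotone h'')

theorem ofNLax_comp_ordMap (f : I →o J) (F : StrictlyUnitaryLaxFunctor (LocallyDiscrete J) C) :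
    ofNLax ((UnaryOperadic.toNLax (ordMap f)).comp F) = (ofNLax F).restrict f := by
  have h : ∀ {i j k : I} (h : i ≤ j) (h' : j ≤ k),
      (ofNLax ((UnaryOperadic.toNLax (ordMap f)).comp F)).comp h h' =
        ((ofNLax F).restrict f).comp h h' := fun {i j k} h h' => by
    refine Eq.trans ?_ (Category.comp_id _)
    exact congrArg _ (map₂_eq F _)
  exact ext' (F := ofNLax ((UnaryOperadic.toNLax (ordMap f)).comp F)) rfl HEq.rfl
    (heq_of_eq (by funext i j k h₁ h₂; exact h h₁ h₂))

end LaxSimplex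

section

open MonoidalCategory

variable {I J : Type} [Preorder I] [Preorder J] {M : Type u} [Category.{v} M] [MonoidalCategory M]

theorem whiskerLeft_eqToHom' {x y z : M} (h : y = z) :
    x ◁ eqToHom h = eqToHom (congrArg (fun t => x ⊗ t) h) := by
  cases h; simp

theorem para_hom_eq {x y : Para M} {f g h : ParaHom x y} (e : f = g) (θ : g ⟶ h) (η : f ⟶ h)
    (w : η = eqToHom e ≫ θ) :
    η.hom = eqToHom (by rw [e]) ≫ θ.hom := by
  cases e; cases w; simp

theorem para_left_eq {x y : Para M} (p : x ⟶ x) (q : x ⟶ y) (e : p = 𝟙 x) (η : p ≫ q ⟶ q)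
    (w : η.hom = eqToHom (by rw [e]; rfl) ≫ (ρ_ (ParaHom.a q)).hom) :
    η = eqToHom (by rw [e]) ≫ (Bicategory.leftUnitor q).hom := by
  subst e
  apply paraHom₂_ext
  rw [w]
  exact (congrArg ParaHom₂.hom (Category.id_comp (Bicategory.leftUnitor q).hom)).symm ▸
    Category.id_comp _

theorem para_right_eq {x y : Para M} (p : y ⟶ y) (q : x ⟶ y) (e : p = 𝟙 y) (η : q ≫ p ⟶ q)
    (w : η.hom = eqToHom (by rw [e]; rfl) ≫ (λ_ (ParaHom.a q)).hom) :
    η = eqToHom (by rw [e]) ≫ (Bicategory.rightUnitor q).hom := by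
  subst e
  apply paraHom₂_ext
  rw [w]
  exact (congrArg ParaHom₂.hom (Category.id_comp (Bicategory.rightUnitor q).hom)).symm ▸
    Category.id_comp _

theorem toPara_map_id (S : LaxSimplex (WithTop I) (Deloop M)) (i : I) :
    (⟨S.map (WithTop.coe_le_coe.2 (le_refl i)),
      S.comp (WithTop.coe_le_coe.2 (le_refl i)) le_top⟩ :
        ParaHom (⟨S.map (le_top : (i : WithTop I) ≤ ⊤)⟩ : Para M)
          ⟨S.map (le_top : (i : WithTop I) ≤ ⊤)⟩) = ParaHom.id _ :=
  paraHom_ext (S.map_id i) (by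
  refine Eq.trans ?_ (S.id_left (le_top (a := (i : WithTop I)))).symm
  exact congrArg (fun t => t ≫ 
    (MonoidalCategoryStruct.rightUnitor (C := M) (S.map (le_top (a := (i : WithTop I))))).hom)
    (whiskerLeft_eqToHom' (M := M) (S.map_id i)))

/-- A simplex of `BM` with a top vertex, regarded as a simplex of `Para M`. -/
def toPara (S : LaxSimplex (WithTop I) (Deloop M)) : LaxSimplex I (Para M) where
  obj i := ⟨S.map (le_top : (i : WithTop I) ≤ ⊤)⟩
  map h := ⟨S.map (WithTop.coe_le_coe.2 h), S.comp (WithTop.coe_le_coe.2 h) le_top⟩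
  comp {_ _ k} h h' := ⟨S.comp (WithTop.coe_le_coe.2 h) (WithTop.coe_le_coe.2 h'),
    S.assoc (WithTop.coe_le_coe.2 h) (WithTop.coe_le_coe.2 h') (le_top (a := (k : WithTop I)))⟩
  map_id i := toPara_map_id S i
  id_left h :=
    para_left_eq _ _ (toPara_map_id S _) _ (S.id_left (WithTop.coe_le_coe.2 h))
  id_right h :=
    para_right_eq _ _ (toPara_map_id S _) _ (S.id_right (WithTop.coe_le_coe.2 h))
  assoc h h' h'' := paraHom₂_ext
    (S.assoc (WithTop.coe_le_coe.2 h) (WithTop.coe_le_coe.2 h') (WithTop.coe_le_coe.2 h''))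

theorem not_top_le {i : I} (h : (⊤ : WithTop I) ≤ i) : False :=
  WithTop.not_top_le_coe i h

theorem para_map_eq {x y : Para M} {f g : ParaHom x y} (h : f = g) :
    f.map = eqToHom (by rw [h]) ≫ g.map := by
  cases h; simp

/-- The 1-cells of the simplex of `BM` that corresponds to a simplex of `Para M`. -/
def ofParaMap (T : LaxSimplex I (Para M)) : ∀ i j : WithTop I, i ≤ j → M
  | some _, some _, h => (T.map (WithTop.coe_le_coe.1 h)).a
  | some i, none, _ => (T.obj i).obj
  | none, some _, h => (not_top_le h).elim
  | none, none, _ => 𝟙_ M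

/-- The 2-cells of the simplex of `BM` that corresponds to a simplex of `Para M`. -/
def ofParaComp (T : LaxSimplex I (Para M)) : ∀ (i j k : WithTop I) (h : i ≤ j) (h' : j ≤ k),
    ofParaMap T j k h' ⊗ ofParaMap T i j h ⟶ ofParaMap T i k (h.trans h')
  | some _, some _, some _, h, h' => (T.comp (WithTop.coe_le_coe.1 h) (WithTop.coe_le_coe.1 h')).hom
  | some _, some _, none, h, _ => (T.map (WithTop.coe_le_coe.1 h)).map
  | some i, none, none, _, _ => (λ_ (T.obj i).obj).hom
  | none, none, none, _, _ => (λ_ (𝟙_ M)).hom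
  | none, some _, _, h, _ => (not_top_le h).elim
  | _, none, some _, _, h => (not_top_le h).elim

theorem ofPara_assoc_aux {x y a : M} (f : y ⊗ a ⟶ x) :
    𝟙_ M ◁ f ≫ (λ_ x).hom = (α_ (𝟙_ M) y a).inv ≫ (λ_ y).hom ▷ a ≫ f := by
  simp

/-- The simplex of `BM` that corresponds to a simplex of `Para M`. -/
def ofPara (T : LaxSimplex I (Para M)) : LaxSimplex (WithTop I) (Deloop M) where
  obj _ := ⟨⟩
  map h := ofParaMap T _ _ h
  comp h h' := ofParaComp T _ _ _ h h'
  map_id i := match i with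
    | some i => congrArg ParaHom.a (T.map_id i)
    | none => rfl
  id_left {i j} h := match i, j, h with
    | some i, some j, h => para_hom_eq _ _ _ (T.id_left (WithTop.coe_le_coe.1 h))
    | some i, none, h => (para_map_eq (T.map_id i))
    | none, some _, h => (not_top_le h).elim
    | none, none, _ => by
      refine Eq.trans ?_ (Category.id_comp (ρ_ (𝟙_ M)).hom).symm
      exact MonoidalCategory.unitors_equal
  id_right {i j} h := match i, j, h with
    | some i, some j, h => para_hom_eq _ _ _ (T.id_right (WithTop.coe_le_coe.1 h))
    | some i, none, _ => (Category.id_comp (λ_ (T.obj i).obj).hom).symm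
    | none, some _, h => (not_top_le h).elim
    | none, none, _ => (Category.id_comp (λ_ (𝟙_ M)).hom).symm
  assoc {i j k l} h h' h'' := match i, j, k, l, h, h', h'' with
    | some _, some _, some _, some _, h, h', h'' => congrArg ParaHom₂.hom
        (T.assoc (WithTop.coe_le_coe.1 h) (WithTop.coe_le_coe.1 h') (WithTop.coe_le_coe.1 h''))
    | some _, some _, some _, none, h, h', _ =>
        (T.comp (WithTop.coe_le_coe.1 h) (WithTop.coe_le_coe.1 h')).w
    | some _, some _, none, none, h, _, _ =>
        ofPara_assoc_aux (T.map (WithTop.coe_le_coe.1 h)).map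
    | some i, none, none, none, _, _, _ => ofPara_assoc_aux (λ_ (T.obj i).obj).hom
    | none, none, none, none, _, _, _ => ofPara_assoc_aux (λ_ (𝟙_ M)).hom
    | none, some _, _, _, h, _, _ => (not_top_le h).elim
    | _, none, some _, _, _, h, _ => (not_top_le h).elim
    | _, _, none, some _, _, _, h => (not_top_le h).elim

theorem toPara_ofPara (T : LaxSimplex I (Para M)) : toPara (ofPara T) = T := rfl

theorem deloop_ext {S T : LaxSimplex I (Deloop M)}
    (h₁ : ∀ (i j : I) (h : i ≤ j), S.map h = (T.map h : M))
    (h₂ : ∀ (i j k : I) (h : i ≤ j) (h' : j ≤ k), HEq (S.comp h h') (T.comp h h')) : S = T := by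
  obtain ⟨o, m, c, _, _, _, _⟩ := S
  obtain ⟨o', m', c', _, _, _, _⟩ := T
  obtain rfl : o = o' := funext fun _ => rfl
  obtain rfl : @m = @m' := by
    funext i j h
    exact h₁ i j h
  obtain rfl : @c = @c' := by
    funext i j k h h'
    exact eq_of_heq (h₂ i j k h h')
  rfl

theorem ofPara_toPara_map (S : LaxSimplex (WithTop I) (Deloop M)) :
    ∀ (i j : WithTop I) (h : i ≤ j), (ofPara (toPara S)).map h = (S.map h : M)
  | some _, some _, _ => rfl
  | some _, none, _ => rfl
  | none, some _, h => (not_top_le h).elim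
  | none, none, _ => (S.map_id none).symm

theorem ofPara_toPara_comp_aux {x y z : M} (h : x = 𝟙_ M) (e : x ⊗ y = 𝟙_ M ⊗ y) (hz : y = z)
    (c : x ⊗ y ⟶ y) (hc : c = eqToHom e ≫ (λ_ y).hom) : HEq (λ_ z).hom c := by
  subst h hz hc
  simp

theorem ofPara_toPara (S : LaxSimplex (WithTop I) (Deloop M)) : ofPara (toPara S) = S := by
  refine deloop_ext (ofPara_toPara_map S) ?_
  intro i j k h h'
  match i, j, k, h, h' with
  | some _, some _, some _, _, _ => exact HEq.rfl
  | some _, some _, none, _, _ => exact HEq.rfl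
  | some i, none, none, h, h' =>
    exact ofPara_toPara_comp_aux (M := M) (S.map_id none) _ rfl _ (S.id_right h)
  | none, none, none, h, h' =>
    exact ofPara_toPara_comp_aux (M := M) (S.map_id none) _ (S.map_id none) _ (S.id_right h)
  | none, some _, _, h, _ => exact (not_top_le h).elim
  | _, none, some _, _, h => exact (not_top_le h).elim

/-- Simplices of `BM` with a top vertex are the same as simplices of `Para M`. -/
def paraEquiv : LaxSimplex (WithTop I) (Deloop M) ≃ LaxSimplex I (Para M) where
  toFun := toPara
  invFun := ofPara
  left_inv := ofPara_toPara
  right_inv := toPara_ofPara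

end

end DecNerve

section DecNerveIso

open Opposite

/-- The monotone bijection from an ordinal with a new top element to the next ordinal. -/
def addTopHom (n : ℕ) : WithTop (Fin n) →o Fin (n + 1) where
  toFun
    | some i => i.castSucc
    | none => Fin.last n
  monotone' i j h := match i, j, h with
    | some _, some _, h => Fin.castSucc_le_castSucc_iff.2 (WithTop.coe_le_coe.1 h)
    | _, none, _ => Fin.le_last _
    | none, some _, h => (not_top_le h).elim

/-- The inverse of `addTopHom`. -/
def addTopInv (n : ℕ) : Fin (n + 1) →o WithTop (Fin n) where
  toFun := Fin.lastCases (motive := fun _ => WithTop (Fin n)) ⊤ (fun i => (i : WithTop (Fin n)))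
  monotone' := by
    intro i j h
    induction j using Fin.lastCases with
    | last => simp
    | cast j =>
      induction i using Fin.lastCases with
      | last => exact absurd h (by simp [Fin.le_def])
      | cast i => simpa using h

theorem addTopInv_last (n : ℕ) : addTopInv n (Fin.last n) = ⊤ :=
  Fin.lastCases_last (motive := fun _ => WithTop (Fin n))
    (last := ⊤) (cast := fun i => WithTop.some i)

theorem addTopInv_castSucc {n : ℕ} (i : Fin n) : addTopInv n i.castSucc = i :=
  Fin.lastCases_castSucc (motive := fun _ => WithTop (Fin n)) (last := ⊤)
    (cast := fun i => WithTop.some i) i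

theorem addTopHom_comp_inv (n : ℕ) : (addTopHom n).comp (addTopInv n) = OrderHom.id := by
  ext i : 2
  change addTopHom n (addTopInv n i) = i
  induction i using Fin.lastCases with
  | last => rw [addTopInv_last]; rfl
  | cast i => rw [addTopInv_castSucc]; rfl

theorem addTopInv_comp_hom (n : ℕ) : (addTopInv n).comp (addTopHom n) = OrderHom.id := by
  ext i : 2
  match i with
  | none => exact addTopInv_last n
  | some i => exact addTopInv_castSucc i

theorem addTopHom_natural {n m : ℕ} (f : Fin n →o Fin m) :
    (topExtend f).comp (addTopHom n) = (addTopHom m).comp f.withTopMap := by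
  ext i : 2
  match i with
  | none => exact topExtend_last f
  | some i => exact topExtend_castSucc f i

/-- Restriction of simplices along `addTopHom` is a bijection. -/
def restrictTopEquiv (n : ℕ) (C : Type u) [Bicategory.{w, v} C] :
    LaxSimplex (Fin (n + 1)) C ≃ LaxSimplex (WithTop (Fin n)) C where
  toFun S := S.restrict (addTopHom n)
  invFun S := S.restrict (addTopInv n)
  left_inv S := congrArg (fun f => S.restrict f) (addTopHom_comp_inv n)
  right_inv S := congrArg (fun f => S.restrict f) (addTopInv_comp_hom n)

variable (M : Type u) [Category.{u} M] [MonoidalCategory M]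

/-- The bijection between `(n+1)`-simplices of `BM` and `n`-simplices of `Para M`. -/
def decNerveEquiv (n : ℕ) :
    StrictlyUnitaryLaxFunctor (LocallyDiscrete (Fin (n + 1))) (Deloop M) ≃
      StrictlyUnitaryLaxFunctor (LocallyDiscrete (Fin n)) (Para M) :=
  LaxSimplex.equivNLax.trans ((restrictTopEquiv n (Deloop M)).trans
    (paraEquiv.trans LaxSimplex.equivNLax.symm))

theorem decNerveEquiv_natural {n m : ℕ} (f : Fin n →o Fin m)
    (σ : StrictlyUnitaryLaxFunctor (LocallyDiscrete (Fin (m + 1))) (Deloop M)) :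
    decNerveEquiv M n ((toNLax (ordMap (topExtend f))).comp σ) =
      (toNLax (ordMap f)).comp (decNerveEquiv M m σ) := by
  apply LaxSimplex.equivNLax.injective
  refine Eq.trans ?_ (LaxSimplex.ofNLax_comp_ordMap f _).symm
  refine (LaxSimplex.equivNLax.apply_symm_apply _).trans ?_
  have h := LaxSimplex.ofNLax_comp_ordMap (topExtend f) σ
  have h' := congrArg (fun S => toPara (S.restrict (addTopHom n))) h
  refine h'.trans ?_
  exact congrArg (fun g => toPara ((LaxSimplex.ofNLax σ).restrict g)) (addTopHom_natural f)

/-- The isomorphism between the upper décalage of the nerve of `BM` and the nerve of `Para M`: an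
`(n+1)`-simplex of `BM` with edges `f i j` and triangles `α i j k` corresponds to the `n`-simplex
of `Para M` with vertices `f i (n+1)`, edges `(f i j, α i j (n+1))` and triangles `α i j k`. -/
def decNerveIso : dec (duskinNerve (Deloop M)) ≅ duskinNerve (Para M) :=
  NatIso.ofComponents (fun n => (decNerveEquiv M (n.unop.len + 1)).toIso) (fun {n m} f => by
    ext σ
    exact decNerveEquiv_natural M f.unop.toOrderHom σ)

end DecNerveIso

/-! ## The functors `Ψ` and `∫` -/

section Functors

open Opposite

theorem deloop_id (M : StrMonCat.{u}) :
    toNLax (StrictMonoidalFunctor.deloop (𝟙 M : StrictMonoidalFunctor M.carrier M.carrier)) =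
      StrictlyUnitaryLaxFunctor.id (Deloop M.carrier) := by
  rfl

theorem eqToHom_comp_map {M N P : StrMonCat.{u}} (F : M ⟶ N) (G : N ⟶ P) (x y : M.carrier) :
    eqToHom ((StrictMonoidalFunctor.comp F G).obj_tensor x y).symm =
      eqToHom (StrictMonoidalFunctor.obj_tensor G (F.obj x) (F.obj y)).symm ≫
        G.map (eqToHom (StrictMonoidalFunctor.obj_tensor F x y).symm) := by
  rw [eqToHom_map, eqToHom_trans]
  rfl

theorem deloop_comp {M N P : StrMonCat.{u}} (F : M ⟶ N) (G : N ⟶ P) :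
    toNLax (StrictMonoidalFunctor.deloop (F ≫ G : StrictMonoidalFunctor M.carrier P.carrier)) =
      (toNLax (StrictMonoidalFunctor.deloop F)).comp (toNLax (StrictMonoidalFunctor.deloop G)) := by
  refine nlax_ext' rfl HEq.rfl ?_ ?_
  · apply heq_of_eq
    funext a
    rw [StrictlyUnitaryLaxFunctor.mapId_eq_eqToHom]
    exact (((toNLax (StrictMonoidalFunctor.deloop F)).comp
      (toNLax (StrictMonoidalFunctor.deloop G))).mapId_eq_eqToHom a).symm
  · apply heq_of_eq
    funext a b c f g
    exact eqToHom_comp_map F G g f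

/-- The functor that takes a strict monoidal category `M` to the nerve of `BM`. -/
def nerveDeloop : StrMonCat.{u} ⥤ SSet.{u} where
  obj M := duskinNerve (Deloop M.carrier)
  map F := duskinNerveMap (toNLax (StrictMonoidalFunctor.deloop F))
  map_id M := by
    ext n σ
    exact (congrArg (fun F => StrictlyUnitaryLaxFunctor.comp σ F) (deloop_id M)).trans
      (StrictlyUnitaryLaxFunctor.comp_id σ)
  map_comp F G := by
    ext n σ
    exact (congrArg (fun F => StrictlyUnitaryLaxFunctor.comp σ F) (deloop_comp F G)).trans
      (StrictlyUnitaryLaxFunctor.comp_assoc σ _ _).symm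

/-- `Ψ M` is the 3-truncation of the nerve of `BM`. -/
def Psi : StrMonCat.{u} ⥤ SSet.Truncated.{u} 3 := nerveDeloop ⋙ SSet.truncation 3

/-- The functor `∫ : StrMonCat ⥤ UOpCat`, the operadic Grothendieck construction over the terminal
unary operadic 2-category. It takes a strict monoidal category `M` to the unary operadic
2-category `(N(BM), Para M)`. -/
def integral : StrMonCat.{u} ⥤ UOpCat.{u} where
  obj M :=
    { X := nerveDeloop.obj M
      C := Para M.carrier
      iso := decNerveIso M.carrier }
  map F := ⟨nerveDeloop.map F⟩
  map_id M := InducedCategory.hom_ext (nerveDeloop.map_id M)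
  map_comp F G := InducedCategory.hom_ext (nerveDeloop.map_comp F G)

end Functors

/-! ## The strict monoidal categories generated by simplices -/

section Generators

open MonoidalCategory Opposite

/-- The edges `f i j`, `i < j`, of the `n`-simplex. -/
@[ext]
structure Edge (n : ℕ) where
  src : Fin (n + 1)
  tgt : Fin (n + 1)
  lt : src < tgt

/-- The generating multimorphisms: for every path `i = p₀ < p₁ < ⋯ < pₘ = j` there is exactly one
from the list `f pₘ₋₁ pₘ, …, f p₁ p₂, f p₀ p₁` to `f i j`. For `n ≤ 3` these are the identities
(`m = 1`), the triangles `α i j k : f j k, f i j ⟶ f i k` (`m = 2`), and the tetrahedron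
`σ : f 2 3, f 1 2, f 0 1 ⟶ f 0 3` (`m = 3`). -/
inductive IsCell {n : ℕ} : List (Edge n) → Edge n → Prop
  | id (e : Edge n) : IsCell [e] e
  | cons {i j k : Fin (n + 1)} (h : i < j) (h' : j < k) {l : List (Edge n)} :
      IsCell l ⟨i, j, h⟩ → IsCell (⟨j, k, h'⟩ :: l) ⟨i, k, h.trans h'⟩

/-- The objects of `Φ₀[n]`: lists of edges of the `n`-simplex. -/
@[ext]
structure SimplexMon (n : ℕ) : Type u where
  edges : List (Edge n)

/-- The morphisms of `Φ₀[n]` from a list `a` to a list `b = (b₁, …, bₗ)`: tuples `(g₁, …, gₗ)` of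
generating multimorphisms, where `gᵢ` has target `bᵢ` and the sources of the `gᵢ` concatenate
to `a`. (A multimorphism is determined by its source and its target, so that it is enough to record
the list of the sources.) -/
@[ext]
structure SimplexMonHom {n : ℕ} (a b : SimplexMon.{u} n) : Type u where
  sources : List (List (Edge n))
  flatten_eq : sources.flatten = a.edges
  cells : List.Forall₂ IsCell sources b.edges

namespace IsCell

variable {n : ℕ}

theorem prefix_unique {l l' r r' : List (Edge n)} {e : Edge n} (h : IsCell l e)
    (h' : IsCell l' e) (w : l ++ r = l' ++ r') : l = l' := by
  induction h generalizing l' with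
  | id e =>
    cases h' with
    | id => rfl
    | cons p q _ =>
      simp at w
      exact absurd w.1 p.ne
  | cons p q _ ih =>
    cases h' with
    | id =>
      simp at w
      exact absurd w.1 p.ne'
    | cons p' q' h' =>
      simp at w
      obtain ⟨rfl, w⟩ := w
      rw [ih h' w]

theorem sources_unique {d d' : List (List (Edge n))} {b : List (Edge n)}
    (h : List.Forall₂ IsCell d b) (h' : List.Forall₂ IsCell d' b)
    (w : d.flatten = d'.flatten) : d = d' := by
  induction h generalizing d' with
  | nil => cases h'; rfl
  | cons p _ ih =>
    cases h' with
    | cons p' h' =>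
      simp only [List.flatten_cons] at w
      obtain rfl := prefix_unique p p' w
      rw [ih h' (List.append_cancel_left w)]

theorem append {i j k : Fin (n + 1)} (h : i < j) (h' : j < k) {l l' : List (Edge n)}
    (p : IsCell l ⟨j, k, h'⟩) (q : IsCell l' ⟨i, j, h⟩) : IsCell (l ++ l') ⟨i, k, h.trans h'⟩ := by
  generalize he : (⟨j, k, h'⟩ : Edge n) = e at p
  induction p generalizing j k with
  | id e => subst he; exact .cons h h' q
  | cons s t _ ih =>
    obtain ⟨rfl, rfl⟩ := Edge.mk.inj he
    exact .cons (h.trans s) t (ih h s q rfl)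

theorem flatten {d : List (List (Edge n))} {l : List (Edge n)} {e : Edge n}
    (h : List.Forall₂ IsCell d l) (p : IsCell l e) : IsCell d.flatten e := by
  induction p generalizing d with
  | id e =>
    cases h with
    | cons q h => cases h; simpa using q
  | cons s t _ ih =>
    cases h with
    | cons q h => exact append s t q (ih h)

theorem comp {d e : List (List (Edge n))} {b c : List (Edge n)} (h : List.Forall₂ IsCell d b)
    (h' : List.Forall₂ IsCell e c) (w : e.flatten = b) :
    ∃ d' : List (List (Edge n)), d'.flatten = d.flatten ∧ List.Forall₂ IsCell d' c := by
  induction h' generalizing d b with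
  | nil => subst w; cases h; exact ⟨[], rfl, .nil⟩
  | @cons l x e c p _ ih =>
    subst w
    have h₁ := List.forall₂_take_append d l _ h
    have h₂ := List.forall₂_drop_append d l _ h
    obtain ⟨d', w, h'⟩ := ih h₂ rfl
    refine ⟨(d.take l.length).flatten :: d', ?_, .cons (flatten h₁ p) h'⟩
    rw [List.flatten_cons, w, ← List.flatten_append, List.take_append_drop]

theorem id_list (l : List (Edge n)) : List.Forall₂ IsCell (l.map fun e => [e]) l := by
  induction l with
  | nil => exact .nil
  | cons e l ih => exact .cons (.id e) ih

theorem flatten_id_list (l : List (Edge n)) : (l.map fun e => [e]).flatten = l := by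
  induction l with
  | nil => rfl
  | cons e l ih => simp only [List.map_cons, List.flatten_cons, ih, List.singleton_append]

end IsCell

namespace SimplexMon

variable {n : ℕ}

instance (a b : SimplexMon.{u} n) : Subsingleton (SimplexMonHom a b) where
  allEq f g := SimplexMonHom.ext
    (IsCell.sources_unique f.cells g.cells (f.flatten_eq.trans g.flatten_eq.symm))

theorem nonempty_comp {a b c : SimplexMon.{u} n} (f : SimplexMonHom a b)
    (g : SimplexMonHom b c) : Nonempty (SimplexMonHom a c) :=
  let ⟨d, w, h⟩ := IsCell.comp f.cells g.cells g.flatten_eq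
  ⟨⟨d, w.trans f.flatten_eq, h⟩⟩

/-- There is at most one morphism between any two objects of `Φ₀[n]`, and the composite is the only
morphism from the source of the first to the target of the second. -/
noncomputable instance : Category.{u} (SimplexMon.{u} n) where
  Hom a b := SimplexMonHom a b
  id a := ⟨a.edges.map fun e => [e], IsCell.flatten_id_list _, IsCell.id_list _⟩
  comp f g := Classical.choice (nonempty_comp f g)
  id_comp _ := Subsingleton.elim (α := SimplexMonHom _ _) _ _
  comp_id _ := Subsingleton.elim (α := SimplexMonHom _ _) _ _
  assoc _ _ _ := Subsingleton.elim (α := SimplexMonHom _ _) _ _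

instance (a b : SimplexMon.{u} n) : Subsingleton (a ⟶ b) :=
  inferInstanceAs (Subsingleton (SimplexMonHom a b))

/-- Juxtaposition of tuples. -/
def tensorHom {a b c d : SimplexMon.{u} n} (f : a ⟶ b) (g : c ⟶ d) :
    (⟨a.edges ++ c.edges⟩ : SimplexMon.{u} n) ⟶ ⟨b.edges ++ d.edges⟩ :=
  SimplexMonHom.mk (SimplexMonHom.sources f ++ SimplexMonHom.sources g)
    (by simp [SimplexMonHom.flatten_eq])
    (List.rel_append (SimplexMonHom.cells f) (SimplexMonHom.cells g))

/-- The tensor product is the concatenation of lists and the unit is the empty list. -/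
noncomputable instance : MonoidalCategory (SimplexMon.{u} n) where
  tensorObj a b := ⟨a.edges ++ b.edges⟩
  tensorUnit := ⟨[]⟩
  tensorHom f g := tensorHom f g
  whiskerLeft a _ _ f := tensorHom (𝟙 a) f
  whiskerRight f a := tensorHom f (𝟙 a)
  associator a b c := eqToIso (SimplexMon.ext (List.append_assoc a.edges b.edges c.edges))
  leftUnitor a := eqToIso (SimplexMon.ext (List.nil_append a.edges))
  rightUnitor a := eqToIso (SimplexMon.ext (List.append_nil a.edges))
  tensorHom_def _ _ := Subsingleton.elim _ _
  id_tensorHom_id _ _ := Subsingleton.elim _ _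
  tensorHom_comp_tensorHom _ _ _ _ := Subsingleton.elim _ _
  whiskerLeft_id _ _ := Subsingleton.elim _ _
  id_whiskerRight _ _ := Subsingleton.elim _ _
  associator_naturality _ _ _ := Subsingleton.elim _ _
  leftUnitor_naturality _ := Subsingleton.elim _ _
  rightUnitor_naturality _ := Subsingleton.elim _ _
  pentagon _ _ _ _ := Subsingleton.elim _ _
  triangle _ _ := Subsingleton.elim _ _

instance : StrictMonoidal (SimplexMon.{u} n) where
  unit_tensor a := SimplexMon.ext (List.nil_append a.edges)
  tensor_unit a := SimplexMon.ext (List.append_nil a.edges)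
  tensor_assoc a b c := SimplexMon.ext (List.append_assoc a.edges b.edges c.edges)
  leftUnitor_eq _ := rfl
  rightUnitor_eq _ := rfl
  associator_eq _ _ _ := rfl

end SimplexMon

/-- The list `(f i j)` if `i < j`, and the empty list otherwise. -/
def edgeList {n : ℕ} (i j : Fin (n + 1)) : List (Edge n) :=
  if h : i < j then [⟨i, j, h⟩] else []

theorem edgeList_of_lt {n : ℕ} {i j : Fin (n + 1)} (h : i < j) : edgeList i j = [⟨i, j, h⟩] :=
  dif_pos h

theorem edgeList_self {n : ℕ} (i : Fin (n + 1)) : edgeList i i = [] :=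
  dif_neg (lt_irrefl i)

/-- The triangle with vertices `i ≤ j ≤ k`. -/
theorem nonempty_triangle {n : ℕ} {i j k : Fin (n + 1)} (h : i ≤ j) (h' : j ≤ k) :
    Nonempty ((⟨edgeList j k ++ edgeList i j⟩ : SimplexMon.{u} n) ⟶ ⟨edgeList i k⟩) := by
  rcases h.eq_or_lt with rfl | p
  · rw [edgeList_self, List.append_nil]; exact ⟨𝟙 _⟩
  rcases h'.eq_or_lt with rfl | q
  · rw [edgeList_self, List.nil_append]; exact ⟨𝟙 _⟩
  refine ⟨SimplexMonHom.mk [edgeList j k ++ edgeList i j] (by simp) ?_⟩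
  simp only [edgeList_of_lt p, edgeList_of_lt q, edgeList_of_lt (p.trans q)]
  exact .cons (.cons p q (.id _)) .nil

/-- The generating `n`-simplex of `Φ₀[n]`, with edges `f i j` and the evident triangles. -/
noncomputable def genSimplex (n : ℕ) :
    StrictlyUnitaryLaxFunctor (LocallyDiscrete (Fin (n + 1))) (Deloop (SimplexMon.{u} n)) :=
  LaxSimplex.toNLax
    { obj := fun _ => ⟨⟩
      map := fun {i j} _ => (⟨edgeList i j⟩ : SimplexMon.{u} n)
      comp := fun h h' => Classical.choice (nonempty_triangle h h')
      map_id := fun i => SimplexMon.ext (edgeList_self i)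
      id_left := fun _ => Subsingleton.elim (α := SimplexMonHom _ _) _ _
      id_right := fun _ => Subsingleton.elim (α := SimplexMonHom _ _) _ _
      assoc := fun _ _ _ => Subsingleton.elim (α := SimplexMonHom _ _) _ _ }

section Map

variable {n m : ℕ} (f : Fin (n + 1) →o Fin (m + 1))

/-- The action of a monotone map on lists of edges: `f i j` is sent to `f (f i) (f j)`, or is
deleted if `f i = f j`. -/
def mapEdges (l : List (Edge n)) : List (Edge m) :=
  l.flatMap fun e => edgeList (f e.src) (f e.tgt)

theorem nonempty_mapCell {l : List (Edge n)} {e : Edge n} (h : IsCell l e) :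
    Nonempty ((⟨mapEdges f l⟩ : SimplexMon.{u} m) ⟶ ⟨edgeList (f e.src) (f e.tgt)⟩) := by
  induction h with
  | id e => simpa [mapEdges] using ⟨𝟙 _⟩
  | @cons i j k p q l _ ih =>
    obtain ⟨g⟩ := ih
    obtain ⟨t⟩ := nonempty_triangle.{u} (f.monotone p.le) (f.monotone q.le)
    exact ⟨SimplexMon.tensorHom (𝟙 (⟨edgeList (f j) (f k)⟩ : SimplexMon.{u} m)) g ≫ t⟩

theorem nonempty_mapHom {d : List (List (Edge n))} {b : List (Edge n)}
    (h : List.Forall₂ IsCell d b) :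
    Nonempty ((⟨mapEdges f d.flatten⟩ : SimplexMon.{u} m) ⟶ ⟨mapEdges f b⟩) := by
  induction h with
  | nil => exact ⟨𝟙 _⟩
  | cons p _ ih =>
    obtain ⟨g⟩ := nonempty_mapCell.{u} f p
    obtain ⟨g'⟩ := ih
    have t := SimplexMon.tensorHom g g'
    simp only [mapEdges, List.flatten_cons, List.flatMap_append, List.flatMap_cons] at t ⊢
    exact ⟨t⟩

theorem nonempty_map {a b : SimplexMon.{u} n} (g : a ⟶ b) :
    Nonempty ((⟨mapEdges f a.edges⟩ : SimplexMon.{u} m) ⟶ ⟨mapEdges f b.edges⟩) := by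
  have h := nonempty_mapHom.{u} f (SimplexMonHom.cells g)
  rwa [SimplexMonHom.flatten_eq g] at h

/-- The strict monoidal functor `Φ₀[n] ⥤ Φ₀[m]` induced by a monotone map. -/
noncomputable def simplexMonMap : StrictMonoidalFunctor (SimplexMon.{u} n) (SimplexMon.{u} m) where
  obj a := ⟨mapEdges f a.edges⟩
  map g := Classical.choice (nonempty_map f g)
  map_id _ := Subsingleton.elim _ _
  map_comp _ _ := Subsingleton.elim _ _
  obj_unit := rfl
  obj_tensor a b := SimplexMon.ext (by
    simp only [mapEdges, MonoidalCategoryStruct.tensorObj, List.flatMap_append])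
  map_tensor _ _ := Subsingleton.elim _ _

end Map

theorem simplexMonFunctor_ext {n : ℕ} {M : Type u} [Category.{u} M] [MonoidalCategory M]
    {F G : StrictMonoidalFunctor M (SimplexMon.{u} n)} (h : ∀ x, F.obj x = G.obj x) : F = G :=
  StrictMonoidalFunctor.ext_functor
    (CategoryTheory.Functor.ext h (fun _ _ _ => Subsingleton.elim _ _))

theorem mapEdges_id {n : ℕ} (l : List (Edge n)) : mapEdges OrderHom.id l = l := by
  induction l with
  | nil => rfl
  | cons e l ih =>
    have : mapEdges OrderHom.id (e :: l) = edgeList e.src e.tgt ++ mapEdges OrderHom.id l := rfl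
    rw [this, ih, edgeList_of_lt e.lt]
    rfl

theorem mapEdges_edgeList {n m : ℕ} (f : Fin (n + 1) →o Fin (m + 1)) {i j : Fin (n + 1)}
    (h : i ≤ j) : mapEdges f (edgeList i j) = edgeList (f i) (f j) := by
  rcases h.eq_or_lt with rfl | p
  · simp [edgeList_self, mapEdges]
  · simp [edgeList_of_lt p, mapEdges]

theorem mapEdges_comp {n m k : ℕ} (f : Fin (n + 1) →o Fin (m + 1))
    (g : Fin (m + 1) →o Fin (k + 1)) (l : List (Edge n)) :
    mapEdges (g.comp f) l = mapEdges g (mapEdges f l) := by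
  induction l with
  | nil => rfl
  | cons e l ih =>
    have h₁ : mapEdges (g.comp f) (e :: l) =
      edgeList (g (f e.src)) (g (f e.tgt)) ++ mapEdges (g.comp f) l := rfl
    have h₂ : mapEdges g (mapEdges f (e :: l)) =
        mapEdges g (edgeList (f e.src) (f e.tgt)) ++ mapEdges g (mapEdges f l) := by
      simp [mapEdges]
    rw [h₁, h₂, ih, mapEdges_edgeList g (f.monotone e.lt.le)]

/-- The functor `Φ₀` on the 3-truncated simplex category. -/
noncomputable def PhiZero : SimplexCategory.Truncated 3 ⥤ StrMonCat.{u} where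
  obj n := ⟨SimplexMon.{u} n.obj.len⟩
  map f := simplexMonMap f.hom.toOrderHom
  map_id _ := simplexMonFunctor_ext fun _ => SimplexMon.ext (mapEdges_id _)
  map_comp _ _ := simplexMonFunctor_ext fun _ => SimplexMon.ext (mapEdges_comp _ _ _)

/-- The generating simplex of `Φ₀[n]`, as an `n`-simplex of `Ψ(Φ₀[n])`. -/
noncomputable def genPsi (n : SimplexCategory.Truncated 3) :
    (Psi.{u}.obj (PhiZero.{u}.obj n)).obj (op n) :=
  genSimplex.{u} n.obj.len

end Generators

end UnaryOperadic

/-! An `n`-simplex of the nerve of `BM` consists of edges and triangles in `M`, subject to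
normalisation and to one associativity equation on every `i ≤ j ≤ k ≤ l`. Data thus sit in
dimensions 1 and 2, equations in dimensions up to 3, and this is what makes 3-truncations
sufficient.

Freeness of `Φ₀[n]`: a generating multimorphism is a path from `i` to `j`, and a simplex of `M`
gives it a value, an iterated composite of triangles along the path. The tetrahedron equation makes
this composite independent of the bracketing, so that substitution of paths goes to composition
(`evalCell_append`, `evalCell_flatten`, `evalHom_comp`); this yields a strict monoidal functor. It
is unique because identities and triangles generate `Φ₀[n]`, which has at most one morphism between
two objects (`gen_hom_ext`). The same thinness reduces the second claim to a comparison of edges.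
The bound `n ≤ 3` plays no role in these arguments.

Coskeletality: a compatible family of simplices of dimension at most 3 glues uniquely. Its
1-simplices give the edges, its 2-simplices the triangles, its 3-simplices the associativity
(`Family.glue`, `ext_restrict`).

Adjunctions: `Φ X` is built directly, without colimits in `StrMonCat`. Its objects are words in the
edges of `X`, its morphisms formal composites and tensor products of triangles, and two expressions
are equal when every map `X ⟶ Ψ M`, for every `M`, gives them the same value. All laws then hold
because they hold in each `M`. By Yoneda and the adjunction, `Φ(Δ[n])` corepresents `M ↦ (Ψ M)ₙ`, as
does `Φ₀[n]`, so `Φ` extends `Φ₀`. Since the Yoneda embedding is dense and a left adjoint preserves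
left Kan extensions, `Φ` is `Lan_y Φ₀`. Coskeletality turns maps `X ⟶ N(BM)` into maps `tr₃ X ⟶ Ψ
M`, and morphisms of unary operadic 2-categories are just simplicial maps, whence the other two
adjunctions.

Throughout, morphisms are bundled with their ends (`Mor`), so that strict laws become equations
without transport. -/

namespace UnaryOperadic

/-! ### Bundled morphisms of a strict monoidal category -/

section Mor

open MonoidalCategory

/-- A morphism of a category, together with its source and its target. -/
structure Mor (M : Type u) [Category.{v} M] : Type (max u v) where
  {src : M}
  {tgt : M}
  hom : src ⟶ tgt

namespace Mor

variable {M : Type u} [Category.{v} M]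

theorem mk_injective {x y : M} {f g : x ⟶ y} (h : mk f = mk g) : f = g := by
  simpa using h

/-- In a thin category only the ends matter. This settles the equations between morphisms of
`Φ₀[n]`. -/
theorem ext_of_subsingleton [∀ x y : M, Subsingleton (x ⟶ y)] {f g : Mor M} (h : f.src = g.src)
    (h' : f.tgt = g.tgt) : f = g := by
  obtain ⟨f⟩ := f; obtain ⟨g⟩ := g
  dsimp at h h'
  subst h h'
  rw [Subsingleton.elim f g]

/-- The identity of an object. -/
def id (x : M) : Mor M := ⟨𝟙 x⟩

@[simp] theorem src_id (x : M) : (id x).src = x := rfl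
@[simp] theorem tgt_id (x : M) : (id x).tgt = x := rfl

@[simp]
theorem mk_id (x : M) : mk (𝟙 x) = id x := rfl

@[simp]
theorem mk_eqToHom {x y : M} (h : x = y) : mk (eqToHom h) = id x := by
  cases h; rfl

open Classical in
/-- The composition of morphisms, with a junk value where it is not defined. -/
noncomputable def comp (f g : Mor M) : Mor M :=
  -- With the default value `f` the source of a composite is that of `f` unconditionally; only the
  -- target needs composability.
  if h : f.tgt = g.src then ⟨f.hom ≫ eqToHom h ≫ g.hom⟩ else f

theorem mk_comp {x y z : M} (f : x ⟶ y) (g : y ⟶ z) : mk (f ≫ g) = comp (mk f) (mk g) := by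
  simp [comp]

theorem comp_mk {x y z : M} (f : x ⟶ y) (g : y ⟶ z) : comp (mk f) (mk g) = mk (f ≫ g) :=
  (mk_comp f g).symm

@[simp]
theorem src_comp (f g : Mor M) : (comp f g).src = f.src := by
  unfold comp; split <;> rfl

@[simp]
theorem tgt_comp {f g : Mor M} (h : f.tgt = g.src) : (comp f g).tgt = g.tgt := by
  simp [comp, h]

@[simp]
theorem id_comp {x : M} {f : Mor M} (h : f.src = x) : comp (id x) f = f := by
  subst h
  obtain ⟨f⟩ := f
  exact (mk_comp _ f).symm.trans (by simp)

@[simp]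
theorem comp_id {x : M} {f : Mor M} (h : f.tgt = x) : comp f (id x) = f := by
  subst h
  obtain ⟨f⟩ := f
  exact (mk_comp f _).symm.trans (by simp)

theorem comp_assoc {f g h : Mor M} (w : f.tgt = g.src) (w' : g.tgt = h.src) :
    comp (comp f g) h = comp f (comp g h) := by
  obtain ⟨f⟩ := f; obtain ⟨g⟩ := g; obtain ⟨h⟩ := h
  dsimp at w w'
  subst w w'
  simp [comp_mk]

theorem mk_eqToHom_comp_eqToHom {x y : M} {f : Mor M} (h : x = f.src) (h' : f.tgt = y) :
    mk (eqToHom h ≫ f.hom ≫ eqToHom h') = f := by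
  subst h h'
  simp

@[simp]
theorem mk_comp_eqToHom {x y z : M} (f : x ⟶ y) (h : y = z) : mk (f ≫ eqToHom h) = mk f := by
  subst h; simp

@[simp]
theorem mk_eqToHom_comp {x y z : M} (h : x = y) (f : y ⟶ z) : mk (eqToHom h ≫ f) = mk f := by
  subst h; simp

section Monoidal

variable [MonoidalCategory M]

/-- The tensor product of morphisms. -/
instance : Mul (Mor M) := ⟨fun f g => ⟨f.hom ⊗ₘ g.hom⟩⟩

instance : One (Mor M) := ⟨id (𝟙_ M)⟩

@[simp] theorem src_mul (f g : Mor M) : (f * g).src = f.src ⊗ g.src := rfl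
@[simp] theorem tgt_mul (f g : Mor M) : (f * g).tgt = f.tgt ⊗ g.tgt := rfl
@[simp] theorem src_one : (1 : Mor M).src = 𝟙_ M := rfl
@[simp] theorem tgt_one : (1 : Mor M).tgt = 𝟙_ M := rfl
@[simp] theorem id_unit : id (𝟙_ M) = 1 := rfl

@[simp]
theorem mk_tensorHom {x x' y y' : M} (f : x ⟶ x') (g : y ⟶ y') : mk (f ⊗ₘ g) = mk f * mk g := rfl

@[simp]
theorem mk_whiskerLeft (x : M) {y y' : M} (g : y ⟶ y') : mk (x ◁ g) = id x * mk g := by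
  rw [← id_tensorHom]; rfl

@[simp]
theorem mk_whiskerRight {y y' : M} (g : y ⟶ y') (x : M) : mk (g ▷ x) = mk g * id x := by
  rw [← tensorHom_id]; rfl

theorem id_tensor (x y : M) : id (x ⊗ y) = id x * id y := by
  rw [← mk_id, ← id_tensorHom_id]; rfl

theorem comp_mul_comp {f f' g g' : Mor M} (h : f.tgt = g.src) (h' : f'.tgt = g'.src) :
    comp f g * comp f' g' = comp (f * f') (g * g') := by
  obtain ⟨f⟩ := f; obtain ⟨g⟩ := g; obtain ⟨f'⟩ := f'; obtain ⟨g'⟩ := g'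
  dsimp at h h'
  subst h h'
  simp only [comp_mk, ← mk_tensorHom, tensorHom_comp_tensorHom]

variable [StrictMonoidal M]

/-- Naturality of the associators and unitors, which are identities in a strict `M`, becomes
associativity and unitality on the nose once morphisms carry their ends. -/
instance : Monoid (Mor M) where
  mul_assoc f g h := by
    obtain ⟨f⟩ := f; obtain ⟨g⟩ := g; obtain ⟨h⟩ := h
    have w := congrArg mk (associator_naturality f g h)
    rwa [StrictMonoidal.associator_eq, StrictMonoidal.associator_eq, eqToIso.hom, eqToIso.hom,
      mk_comp_eqToHom, mk_eqToHom_comp] at w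
  one_mul f := by
    obtain ⟨f⟩ := f
    have w := congrArg mk (leftUnitor_naturality f)
    rwa [StrictMonoidal.leftUnitor_eq, StrictMonoidal.leftUnitor_eq, eqToIso.hom, eqToIso.hom,
      mk_comp_eqToHom, mk_eqToHom_comp, mk_whiskerLeft] at w
  mul_one f := by
    obtain ⟨f⟩ := f
    have w := congrArg mk (rightUnitor_naturality f)
    rwa [StrictMonoidal.rightUnitor_eq, StrictMonoidal.rightUnitor_eq, eqToIso.hom, eqToIso.hom,
      mk_comp_eqToHom, mk_eqToHom_comp, mk_whiskerRight] at w

@[simp]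
theorem mk_associator_inv (x y z : M) : mk (α_ x y z).inv = id x * id y * id z := by
  rw [StrictMonoidal.associator_eq, eqToIso.inv, mk_eqToHom, id_tensor, id_tensor, mul_assoc]

@[simp]
theorem mk_leftUnitor_hom (x : M) : mk (λ_ x).hom = id x := by
  rw [StrictMonoidal.leftUnitor_eq, eqToIso.hom, mk_eqToHom, id_tensor, id_unit, one_mul]

@[simp]
theorem mk_rightUnitor_hom (x : M) : mk (ρ_ x).hom = id x := by
  rw [StrictMonoidal.rightUnitor_eq, eqToIso.hom, mk_eqToHom, id_tensor, id_unit, mul_one]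

end Monoidal

end Mor

namespace StrictMonoidalFunctor

variable {M : Type u} [Category.{v} M] [MonoidalCategory M]
  {N : Type u} [Category.{v} N] [MonoidalCategory N]

/-- The action of a strict monoidal functor on morphisms. -/
def mor (F : StrictMonoidalFunctor M N) (f : Mor M) : Mor N := ⟨F.map f.hom⟩

variable (F : StrictMonoidalFunctor M N)

@[simp] theorem src_mor (f : Mor M) : (F.mor f).src = F.obj f.src := rfl
@[simp] theorem tgt_mor (f : Mor M) : (F.mor f).tgt = F.obj f.tgt := rfl

@[simp]
theorem mor_id (x : M) : F.mor (Mor.id x) = Mor.id (F.obj x) :=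
  congrArg Mor.mk (F.map_id x)

theorem mor_comp {f g : Mor M} (h : f.tgt = g.src) :
    F.mor (f.comp g) = (F.mor f).comp (F.mor g) := by
  obtain ⟨f⟩ := f; obtain ⟨g⟩ := g
  dsimp at h
  subst h
  rw [Mor.comp_mk]
  exact (congrArg Mor.mk (F.map_comp f g)).trans (Mor.mk_comp _ _)

@[simp]
theorem mor_mul (f g : Mor M) : F.mor (f * g) = F.mor f * F.mor g := by
  refine (congrArg Mor.mk (F.map_tensor f.hom g.hom)).trans ?_
  rw [Mor.mk_eqToHom_comp, Mor.mk_comp_eqToHom]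
  rfl

/-- The action on objects is recovered from the sources of the images of identities. -/
theorem ext_mor {F G : StrictMonoidalFunctor M N} (h : ∀ f, F.mor f = G.mor f) : F = G := by
  apply ext_functor
  refine CategoryTheory.Functor.ext (fun x => congrArg Mor.src (h (Mor.id x))) fun x y f => ?_
  apply Mor.mk_injective
  exact (h ⟨f⟩).trans ((Mor.mk_eqToHom_comp _ _).trans (Mor.mk_comp_eqToHom _ _)).symm

/-- A strict monoidal functor from its actions on objects and on morphisms. -/
def ofMor (obj : M → N) (mor : Mor M → Mor N) (src : ∀ f, (mor f).src = obj f.src)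
    (tgt : ∀ f, (mor f).tgt = obj f.tgt) (id : ∀ x, mor (Mor.id x) = Mor.id (obj x))
    (comp : ∀ {x y z : M} (f : x ⟶ y) (g : y ⟶ z),
      mor ⟨f ≫ g⟩ = (mor ⟨f⟩).comp (mor ⟨g⟩))
    (unit : obj (𝟙_ M) = 𝟙_ N) (tensor : ∀ x y, obj (x ⊗ y) = obj x ⊗ obj y)
    (mul : ∀ f g, mor (f * g) = mor f * mor g) : StrictMonoidalFunctor M N where
  obj := obj
  map f := eqToHom (src ⟨f⟩).symm ≫ (mor ⟨f⟩).hom ≫ eqToHom (tgt ⟨f⟩)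
  map_id x := by
    apply Mor.mk_injective
    rw [Mor.mk_eqToHom_comp_eqToHom]
    exact id x
  map_comp f g := by
    apply Mor.mk_injective
    rw [Mor.mk_eqToHom_comp_eqToHom, comp, Mor.mk_comp, Mor.mk_eqToHom_comp_eqToHom,
      Mor.mk_eqToHom_comp_eqToHom]
  obj_unit := unit
  obj_tensor := tensor
  map_tensor f g := by
    apply Mor.mk_injective
    refine (Mor.mk_eqToHom_comp_eqToHom _ _).trans ((mul ⟨f⟩ ⟨g⟩).trans (Eq.symm ?_))
    refine (Mor.mk_eqToHom_comp _ _).trans ((Mor.mk_comp_eqToHom _ _).trans ?_)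
    exact congrArg₂ (fun a b : Mor N => a * b) (Mor.mk_eqToHom_comp_eqToHom _ _)
      (Mor.mk_eqToHom_comp_eqToHom _ _)

@[simp]
theorem mor_ofMor (obj : M → N) (mor : Mor M → Mor N) (src tgt id comp unit tensor mul)
    (f : Mor M) : (ofMor obj mor src tgt id comp unit tensor mul).mor f = mor f :=
  Mor.mk_eqToHom_comp_eqToHom _ _

end StrictMonoidalFunctor

end Mor

/-! ### Simplices of the nerve of `BM` as edges and triangles in `M` -/

section MorSimplex

open MonoidalCategory

/-- A simplex of the nerve of `BM`, in terms of objects and morphisms of `M`. -/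
structure MorSimplex (I : Type) [Preorder I] (M : Type u) [Category.{v} M] [MonoidalCategory M]
    [StrictMonoidal M] where
  edge : ∀ {i j : I}, i ≤ j → M
  tri : ∀ {i j k : I}, i ≤ j → j ≤ k → Mor M
  src_tri : ∀ {i j k : I} (h : i ≤ j) (h' : j ≤ k), (tri h h').src = edge h' ⊗ edge h
  tgt_tri : ∀ {i j k : I} (h : i ≤ j) (h' : j ≤ k), (tri h h').tgt = edge (h.trans h')
  edge_self : ∀ i : I, edge (le_refl i) = 𝟙_ M
  tri_left : ∀ {i j : I} (h : i ≤ j), tri (le_refl i) h = Mor.id (edge h)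
  tri_right : ∀ {i j : I} (h : i ≤ j), tri h (le_refl j) = Mor.id (edge h)
  assoc : ∀ {i j k l : I} (h : i ≤ j) (h' : j ≤ k) (h'' : k ≤ l),
    (Mor.id (edge h'') * tri h h').comp (tri (h.trans h') h'') =
      (tri h' h'' * Mor.id (edge h)).comp (tri h (h'.trans h''))

attribute [simp] MorSimplex.src_tri MorSimplex.tgt_tri MorSimplex.edge_self MorSimplex.tri_left
  MorSimplex.tri_right

namespace MorSimplex

variable {I J : Type} [Preorder I] [Preorder J] {M : Type u} [Category.{v} M]
  [MonoidalCategory M] [StrictMonoidal M]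

/-- Triangles determine edges: by normalisation the triangle on `i ≤ i ≤ j` is the identity of the
edge from `i` to `j`. -/
theorem ext_tri {S T : MorSimplex I M}
    (h : ∀ (i j k : I) (h : i ≤ j) (h' : j ≤ k), S.tri h h' = T.tri h h') : S = T := by
  have he : ∀ (i j : I) (h : i ≤ j), S.edge h = T.edge h := fun i j h' => by
    simpa using congrArg Mor.src (h i i j le_rfl h')
  obtain ⟨e, t, _, _, _, _, _, _⟩ := S
  obtain ⟨e', t', _, _, _, _, _, _⟩ := T
  obtain rfl : @e = @e' := by funext i j h; exact he i j h
  obtain rfl : @t = @t' := by funext i j k p q; exact h i j k p q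
  rfl

/-- Restriction along a monotone map. -/
def restrict (f : I →o J) (S : MorSimplex J M) : MorSimplex I M where
  edge h := S.edge (f.monotone h)
  tri h h' := S.tri (f.monotone h) (f.monotone h')
  src_tri _ _ := S.src_tri _ _
  tgt_tri _ _ := S.tgt_tri _ _
  edge_self _ := S.edge_self _
  tri_left _ := S.tri_left _
  tri_right _ := S.tri_right _
  assoc _ _ _ := S.assoc _ _ _

/-- The simplex of `N` that is obtained from a simplex of `M` by applying a functor. -/
def map {N : Type u} [Category.{v} N] [MonoidalCategory N] [StrictMonoidal N]
    (F : StrictMonoidalFunctor M N) (S : MorSimplex I M) : MorSimplex I N where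
  edge h := F.obj (S.edge h)
  tri h h' := F.mor (S.tri h h')
  src_tri h h' := by simp [F.obj_tensor]
  tgt_tri h h' := by simp
  edge_self _ := by simp [F.obj_unit]
  tri_left _ := by simp
  tri_right _ := by simp
  assoc h h' h'' := by
    have := congrArg F.mor (S.assoc h h' h'')
    rw [F.mor_comp (by simp), F.mor_comp (by simp)] at this
    simpa using this

theorem mk_comp_left (S : LaxSimplex I (Deloop M)) {i j : I} (h : i ≤ j) :
    (⟨S.comp (le_refl i) h⟩ : Mor M) = Mor.id (S.map h : M) := by
  rw [S.id_left]
  exact (Mor.mk_eqToHom_comp (M := M) _ _).trans (Mor.mk_rightUnitor_hom (M := M) (S.map h))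

theorem mk_comp_right (S : LaxSimplex I (Deloop M)) {i j : I} (h : i ≤ j) :
    (⟨S.comp h (le_refl j)⟩ : Mor M) = Mor.id (S.map h : M) := by
  rw [S.id_right]
  exact (Mor.mk_eqToHom_comp (M := M) _ _).trans (Mor.mk_leftUnitor_hom (M := M) (S.map h))

/-- Translates the coherence of a lax functor into `Mor`, where the associator is an identity and
drops out. It appears inverted because composition in `BM` reverses the tensor factors. -/
theorem mk_eq_of_assoc {a b c ba cb cba : M} (f : b ⊗ a ⟶ ba) (g : c ⊗ ba ⟶ cba)
    (h : c ⊗ b ⟶ cb) (k : cb ⊗ a ⟶ cba) :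
    c ◁ f ≫ g = (α_ c b a).inv ≫ h ▷ a ≫ k ↔
      (Mor.id c * ⟨f⟩).comp ⟨g⟩ = (⟨h⟩ * Mor.id a).comp ⟨k⟩ := by
  have h₁ : Mor.mk (c ◁ f ≫ g) = (Mor.id c * ⟨f⟩).comp ⟨g⟩ := by
    rw [Mor.mk_comp, Mor.mk_whiskerLeft]
  have h₂ : Mor.mk ((α_ c b a).inv ≫ h ▷ a ≫ k) = (⟨h⟩ * Mor.id a).comp ⟨k⟩ := by
    rw [Mor.mk_comp, Mor.mk_associator_inv, Mor.mk_comp, Mor.mk_whiskerRight, ← Mor.id_tensor,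
      ← Mor.id_tensor, Mor.id_comp (by simp)]
  rw [← h₁, ← h₂]
  exact ⟨congrArg _, Mor.mk_injective⟩

/-- The simplex of `M` that corresponds to a simplex of `BM`. -/
def ofLax (S : LaxSimplex I (Deloop M)) : MorSimplex I M where
  edge h := S.map h
  tri h h' := ⟨S.comp h h'⟩
  src_tri _ _ := rfl
  tgt_tri _ _ := rfl
  edge_self i := S.map_id i
  tri_left h := mk_comp_left S h
  tri_right h := mk_comp_right S h
  assoc h h' h'' :=
    (mk_eq_of_assoc (M := M) (S.comp h h') (S.comp (h.trans h') h'') (S.comp h' h'')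
      (S.comp h (h'.trans h''))).1 (S.assoc h h' h'')

/-- The triangle of a simplex as a morphism. -/
def triHom (S : MorSimplex I M) {i j k : I} (h : i ≤ j) (h' : j ≤ k) :
    S.edge h' ⊗ S.edge h ⟶ S.edge (h.trans h') :=
  eqToHom (S.src_tri h h').symm ≫ (S.tri h h').hom ≫ eqToHom (S.tgt_tri h h')

@[simp]
theorem mk_triHom (S : MorSimplex I M) {i j k : I} (h : i ≤ j) (h' : j ≤ k) :
    Mor.mk (S.triHom h h') = S.tri h h' :=
  Mor.mk_eqToHom_comp_eqToHom _ _

/-- The simplex of `BM` that corresponds to a simplex of `M`. -/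
def toLax (S : MorSimplex I M) : LaxSimplex I (Deloop M) where
  obj _ := ⟨⟩
  map h := S.edge h
  comp h h' := S.triHom h h'
  map_id i := S.edge_self i
  id_left {i j} h := by
    apply Mor.mk_injective (M := M)
    refine (S.mk_triHom _ _).trans ((S.tri_left h).trans ?_)
    exact ((Mor.mk_eqToHom_comp (M := M) _ _).trans
      (Mor.mk_rightUnitor_hom (M := M) (S.edge h))).symm
  id_right {i j} h := by
    apply Mor.mk_injective (M := M)
    refine (S.mk_triHom _ _).trans ((S.tri_right h).trans ?_)
    exact ((Mor.mk_eqToHom_comp (M := M) _ _).trans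
      (Mor.mk_leftUnitor_hom (M := M) (S.edge h))).symm
  assoc h h' h'' :=
    (mk_eq_of_assoc (S.triHom h h') (S.triHom (h.trans h') h'') (S.triHom h' h'')
      (S.triHom h (h'.trans h''))).2 (by simpa using S.assoc h h' h'')

/-- Simplices of `BM` in terms of objects and morphisms of `M`. -/
def laxEquiv : LaxSimplex I (Deloop M) ≃ MorSimplex I M where
  toFun := ofLax
  invFun := toLax
  left_inv S := deloop_ext (fun _ _ _ => rfl) fun i j k h h' => by
    have : Mor.mk ((ofLax S).triHom h h') = ⟨S.comp h h'⟩ := mk_triHom _ _ _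
    exact heq_of_eq (Mor.mk_injective this)
  right_inv S := ext_tri fun i j k h h' => S.mk_triHom h h'

/-- Simplices of the nerve of `BM` in terms of objects and morphisms of `M`. -/
def nlaxEquiv : StrictlyUnitaryLaxFunctor (LocallyDiscrete I) (Deloop M) ≃ MorSimplex I M :=
  LaxSimplex.equivNLax.trans laxEquiv

theorem nlaxEquiv_restrict (f : I →o J)
    (σ : StrictlyUnitaryLaxFunctor (LocallyDiscrete J) (Deloop M)) :
    nlaxEquiv ((toNLax (ordMap f)).comp σ) = (nlaxEquiv σ).restrict f :=
  congrArg ofLax (LaxSimplex.ofNLax_comp_ordMap f σ)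

theorem nlaxEquiv_map {N : Type u} [Category.{v} N] [MonoidalCategory N] [StrictMonoidal N]
    (F : StrictMonoidalFunctor M N)
    (σ : StrictlyUnitaryLaxFunctor (LocallyDiscrete I) (Deloop M)) :
    nlaxEquiv (σ.comp (toNLax F.deloop)) = (nlaxEquiv σ).map F := by
  apply ext_tri
  intro i j k h h'
  -- The structure cell of the composite is the image of the triangle, preceded by the identity
  -- 2-cell of `F.deloop` that expresses `F.obj_tensor`.
  exact Mor.mk_eqToHom_comp (M := N) (F.obj_tensor _ _).symm _

end MorSimplex

end MorSimplex

/-! ### `Φ₀[n]` is free on its generating simplex -/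

section FreeSimplex

open MonoidalCategory

namespace Mor

variable {M : Type u} [Category.{v} M] [MonoidalCategory M]

theorem mul_comp {f g h : Mor M} (w : g.tgt = h.src) :
    f * comp g h = comp (f * g) (id f.tgt * h) := by
  rw [← comp_mul_comp rfl w, comp_id rfl]

theorem comp_mul {f g h : Mor M} (w : f.tgt = g.src) :
    comp f g * h = comp (f * h) (g * id h.tgt) := by
  rw [← comp_mul_comp w rfl, comp_id rfl]

end Mor

namespace MorSimplex

variable {n : ℕ} {M : Type u} [Category.{u} M] [MonoidalCategory M] [StrictMonoidal M]
  (S : MorSimplex (Fin (n + 1)) M)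

/-- The tensor product of a list of edges. -/
def evalObj (l : List (Edge n)) : M := l.foldr (fun e x => S.edge e.lt.le ⊗ x) (𝟙_ M)

@[simp] theorem evalObj_nil : S.evalObj [] = 𝟙_ M := rfl

@[simp]
theorem evalObj_cons (e : Edge n) (l : List (Edge n)) :
    S.evalObj (e :: l) = S.edge e.lt.le ⊗ S.evalObj l := rfl

theorem evalObj_append (l l' : List (Edge n)) :
    S.evalObj (l ++ l') = S.evalObj l ⊗ S.evalObj l' := by
  induction l with
  | nil => simp [StrictMonoidal.unit_tensor]
  | cons e l ih => simp [ih, StrictMonoidal.tensor_assoc]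

/-- The value of the generating multimorphism with given source and target. -/
noncomputable def evalCell : List (Edge n) → Edge n → Mor M
  -- No cell has an empty source, so this value is arbitrary.
  | [], t => Mor.id (S.edge t.lt.le)
  | e :: l, t =>
    -- The head `e` of the source of a cell is the last step of the path. For a cell the test fails
    -- exactly when the path has one step, that is, for the identity.
    if h : t.src < e.src then
      (Mor.id (S.edge e.lt.le) * evalCell l ⟨t.src, e.src, h⟩).comp (S.tri h.le e.lt.le)
    else Mor.id (S.edge t.lt.le)

theorem evalCell_singleton (e : Edge n) : S.evalCell [e] e = Mor.id (S.edge e.lt.le) := by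
  simp [evalCell]

theorem evalCell_cons {i j k : Fin (n + 1)} (h : i < j) (h' : j < k) (l : List (Edge n)) :
    S.evalCell (⟨j, k, h'⟩ :: l) ⟨i, k, h.trans h'⟩ =
      (Mor.id (S.edge h'.le) * S.evalCell l ⟨i, j, h⟩).comp (S.tri h.le h'.le) := by
  simp [evalCell, h]

/-- The value of a tuple of generating multimorphisms. -/
noncomputable def evalHom : List (List (Edge n)) → List (Edge n) → Mor M
  | d :: ds, e :: l => S.evalCell d e * evalHom ds l
  -- Two empty lists form the empty tuple, whose value is the identity of the unit; lists of
  -- different lengths do not occur under `Forall₂`.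
  | _, _ => 1

theorem tgt_evalCell {l : List (Edge n)} {e : Edge n} (h : IsCell l e) :
    (S.evalCell l e).tgt = S.edge e.lt.le := by
  induction h with
  | id e => rw [evalCell_singleton]; rfl
  | cons h h' _ ih => rw [evalCell_cons _ h h', Mor.tgt_comp (by simp [ih]), tgt_tri]

theorem src_evalCell {l : List (Edge n)} {e : Edge n} (h : IsCell l e) :
    (S.evalCell l e).src = S.evalObj l := by
  induction h with
  | id e => rw [evalCell_singleton]; simp [StrictMonoidal.tensor_unit]
  | cons h h' _ ih => rw [evalCell_cons _ h h']; simp [ih]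

theorem src_evalHom {d : List (List (Edge n))} {b : List (Edge n)} (h : List.Forall₂ IsCell d b) :
    (S.evalHom d b).src = S.evalObj d.flatten := by
  induction h with
  | nil => rfl
  | cons h _ ih => simp [evalHom, S.src_evalCell h, ih, evalObj_append]

theorem tgt_evalHom {d : List (List (Edge n))} {b : List (Edge n)} (h : List.Forall₂ IsCell d b) :
    (S.evalHom d b).tgt = S.evalObj b := by
  induction h with
  | nil => rfl
  | cons h _ ih => simp [evalHom, S.tgt_evalCell h, ih]

theorem evalHom_append {d d' : List (List (Edge n))} {b b' : List (Edge n)}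
    (h : List.Forall₂ IsCell d b) :
    S.evalHom (d ++ d') (b ++ b') = S.evalHom d b * S.evalHom d' b' := by
  induction h with
  | nil => simp [evalHom]
  | cons h _ ih => simp [evalHom, ih, mul_assoc]

theorem evalHom_id (l : List (Edge n)) :
    S.evalHom (l.map fun e => [e]) l = Mor.id (S.evalObj l) := by
  induction l with
  | nil => rfl
  | cons e l ih => simp [evalHom, ih, evalCell_singleton, Mor.id_tensor]

/-- The heart of freeness: a path may be cut at any intermediate vertex `j`, not only before its
last step. Induction on the later half moves the cut, one tetrahedron equation at a time. -/
theorem evalCell_append {i j k : Fin (n + 1)} (h : i < j) (h' : j < k) {l l' : List (Edge n)}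
    (p : IsCell l ⟨j, k, h'⟩) (q : IsCell l' ⟨i, j, h⟩) :
    S.evalCell (l ++ l') ⟨i, k, h.trans h'⟩ =
      (S.evalCell l ⟨j, k, h'⟩ * S.evalCell l' ⟨i, j, h⟩).comp (S.tri h.le h'.le) := by
  generalize he : (⟨j, k, h'⟩ : Edge n) = e at p
  induction p generalizing j k with
  | id e =>
    subst he
    rw [evalCell_singleton, List.singleton_append, evalCell_cons _ h h']
  | @cons j t k s s' l p ih =>
    obtain ⟨rfl, rfl⟩ := Edge.mk.inj he
    have hp := S.tgt_evalCell p
    have hq := S.tgt_evalCell q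
    dsimp only at hp hq
    rw [List.cons_append, evalCell_cons _ (h.trans s) s', evalCell_cons _ s s', ih h s q rfl,
      Mor.mul_comp (by simp [hp, hq]), Mor.comp_mul (by simp [hp]),
      -- The tetrahedron `i ≤ j ≤ t ≤ k` replaces the composite through the edge from `i` to `t` by
      -- the one through the edge from `j` to `k`.
      Mor.comp_assoc (by simp [hp, hq]) (by simp), Mor.tgt_id, S.assoc h.le s.le s'.le, hq,
      Mor.comp_assoc (by simp [hp, hq]) (by simp), mul_assoc]

/-- Substituting cells for the edges of a path goes to composition of values: peel off the last step
of the path and cut the refined path there by `evalCell_append`. -/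
theorem evalCell_flatten {d : List (List (Edge n))} {l : List (Edge n)} {e : Edge n}
    (h : List.Forall₂ IsCell d l) (p : IsCell l e) :
    S.evalCell d.flatten e = (S.evalHom d l).comp (S.evalCell l e) := by
  induction p generalizing d with
  | id e =>
    cases h with
    | cons q h =>
      cases h
      simp [evalHom, evalCell_singleton, S.tgt_evalCell q]
  | cons s t p ih =>
    cases h with
    | cons q h =>
      have hq := S.tgt_evalCell q
      have hp := S.src_evalCell p
      have hp' := S.tgt_evalCell p
      have hh := S.tgt_evalHom h
      dsimp only at hq hp'
      rw [List.flatten_cons, S.evalCell_append s t q (IsCell.flatten h p), ih h, evalHom,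
        evalCell_cons _ s t, Mor.mul_comp (by simp [hp, hh]),
        Mor.comp_assoc (by simp [hp, hq, hh]) (by simp [hp', hq]), hq]

/-- Functoriality. The sources `d'` of the composite are produced explicitly because the composition
of `Φ₀[n]` is given only by choice; they are matched with the chosen ones through
`IsCell.sources_unique`. -/
theorem evalHom_comp {d e : List (List (Edge n))} {b c : List (Edge n)}
    (h : List.Forall₂ IsCell d b) (h' : List.Forall₂ IsCell e c) (w : e.flatten = b) :
    ∃ d' : List (List (Edge n)), d'.flatten = d.flatten ∧ List.Forall₂ IsCell d' c ∧
      S.evalHom d' c = (S.evalHom d b).comp (S.evalHom e c) := by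
  induction h' generalizing d b with
  | nil => subst w; cases h; exact ⟨[], rfl, .nil, (Mor.id_comp rfl).symm⟩
  | @cons l x e c p h' ih =>
    subst w
    have h₁ := List.forall₂_take_append d l _ h
    have h₂ := List.forall₂_drop_append d l _ h
    obtain ⟨d', w, h'', q⟩ := ih h₂ rfl
    -- The first `l.length` cells of `d` are those with targets in `l`, the source of the first cell
    -- of `e`; together they flatten to one source.
    refine ⟨(d.take l.length).flatten :: d', ?_, .cons (IsCell.flatten h₁ p) h'', ?_⟩
    · rw [List.flatten_cons, w, ← List.flatten_append, List.take_append_drop]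
    · have r := S.evalHom_append (d' := d.drop l.length) (b' := e.flatten) h₁
      rw [List.take_append_drop] at r
      rw [evalHom, S.evalCell_flatten h₁ p, q, List.flatten_cons, r, evalHom, Mor.comp_mul_comp]
      · rw [S.tgt_evalHom h₁, S.src_evalCell p]
      · rw [S.tgt_evalHom h₂, S.src_evalHom h']

/-- The strict monoidal functor that is determined by a simplex. -/
noncomputable def evalFunctor : StrictMonoidalFunctor (SimplexMon.{u} n) M :=
  StrictMonoidalFunctor.ofMor (fun a => S.evalObj a.edges)
    (fun f => S.evalHom (SimplexMonHom.sources f.hom) f.tgt.edges)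
    (fun f => (S.src_evalHom (SimplexMonHom.cells f.hom)).trans
      (congrArg S.evalObj (SimplexMonHom.flatten_eq f.hom)))
    (fun f => S.tgt_evalHom (SimplexMonHom.cells f.hom))
    (fun x => S.evalHom_id x.edges)
    (fun f g => by
      obtain ⟨d, w, h, e⟩ := S.evalHom_comp (SimplexMonHom.cells f) (SimplexMonHom.cells g)
        (SimplexMonHom.flatten_eq g)
      refine Eq.trans ?_ e
      -- A morphism of `Φ₀[n]` has only one possible list of sources, so the chosen composite has
      -- the sources `d`.
      have : SimplexMonHom.sources (f ≫ g) = d := IsCell.sources_unique (SimplexMonHom.cells _) h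
        ((SimplexMonHom.flatten_eq _).trans (w.trans (SimplexMonHom.flatten_eq f)).symm)
      exact congrArg (fun d => S.evalHom d _) this)
    rfl
    (fun a b => S.evalObj_append a.edges b.edges)
    (fun f g => S.evalHom_append (SimplexMonHom.cells f.hom))

/-- The generating simplex of `Φ₀[n]`. -/
noncomputable def gen (n : ℕ) : MorSimplex (Fin (n + 1)) (SimplexMon.{u} n) :=
  nlaxEquiv (genSimplex n)

theorem edge_gen {i j : Fin (n + 1)} (h : i ≤ j) :
    (gen.{u} n).edge h = ⟨edgeList i j⟩ := rfl

theorem evalObj_edgeList {i j : Fin (n + 1)} (h : i ≤ j) :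
    S.evalObj (edgeList i j) = S.edge h := by
  rcases h.eq_or_lt with rfl | p
  · simp [edgeList_self]
  · simp [edgeList_of_lt p, StrictMonoidal.tensor_unit]

/-- Evaluates a morphism obtained by choice, such as a triangle of `gen`, through any admissible
list of sources. -/
theorem mor_evalFunctor {a b : SimplexMon.{u} n} (f : a ⟶ b) {d : List (List (Edge n))}
    (h : List.Forall₂ IsCell d b.edges) (w : d.flatten = a.edges) :
    S.evalFunctor.mor ⟨f⟩ = S.evalHom d b.edges := by
  refine (StrictMonoidalFunctor.mor_ofMor _ _ _ _ _ _ _ _ _ _).trans ?_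
  have : SimplexMonHom.sources f = d := IsCell.sources_unique (SimplexMonHom.cells _) h
        ((SimplexMonHom.flatten_eq _).trans w.symm)
  exact congrArg (fun d => S.evalHom d _) this

theorem map_evalFunctor_gen : (gen.{u} n).map S.evalFunctor = S := by
  apply ext_tri
  intro i j k h h'
  have he : ∀ {i j : Fin (n + 1)} (h : i ≤ j), ((gen.{u} n).map S.evalFunctor).edge h = S.edge h :=
    fun h => S.evalObj_edgeList h
  -- Degenerate triangles are identities on both sides by normalisation; only `i < j < k` needs
  -- evaluation.
  rcases h.eq_or_lt with rfl | p
  · rw [tri_left, tri_left, he]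
  rcases h'.eq_or_lt with rfl | q
  · rw [tri_right, tri_right, he]
  have hc : IsCell (edgeList j k ++ edgeList i j) (⟨i, k, p.trans q⟩ : Edge n) := by
    rw [edgeList_of_lt p, edgeList_of_lt q]
    exact .cons p q (.id _)
  have hl : edgeList i k = [(⟨i, k, p.trans q⟩ : Edge n)] := edgeList_of_lt _
  refine (S.mor_evalFunctor (d := [edgeList j k ++ edgeList i j]) _ ?_
    (by rw [List.flatten_singleton]; rfl)).trans ?_
  · change List.Forall₂ _ _ (edgeList i k)
    rw [hl]
    exact .cons hc .nil
  · change S.evalHom _ (edgeList i k) = _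
    rw [hl, edgeList_of_lt p, edgeList_of_lt q, List.singleton_append, evalHom,
      evalCell_cons _ p q, evalCell_singleton]
    simp [evalHom, ← Mor.id_tensor]

/-- `Φ₀[n]` is generated by edges and triangles: words are tensor products of edges, cells are
iterated composites of triangles, and morphisms are tensor products of cells. Each such
decomposition is an equation in a thin category, so checking ends suffices. -/
theorem gen_hom_ext {F G : StrictMonoidalFunctor (SimplexMon.{u} n) M}
    (h : (gen.{u} n).map F = (gen.{u} n).map G) : F = G := by
  have he : ∀ e : Edge n, F.obj (⟨[e]⟩ : SimplexMon.{u} n) = G.obj ⟨[e]⟩ := fun e => by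
    have := congrArg (fun S => S.edge e.lt.le) h
    change F.obj (⟨edgeList _ _⟩ : SimplexMon.{u} n) = G.obj ⟨edgeList _ _⟩ at this
    rwa [edgeList_of_lt e.lt] at this
  have ho : ∀ l : List (Edge n), F.obj (⟨l⟩ : SimplexMon.{u} n) = G.obj ⟨l⟩ := fun l => by
    induction l with
    | nil => exact F.obj_unit.trans G.obj_unit.symm
    | cons e l ih =>
      refine (F.obj_tensor ⟨[e]⟩ ⟨l⟩).trans (Eq.trans ?_ (G.obj_tensor ⟨[e]⟩ ⟨l⟩).symm)
      rw [he, ih]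
  have hid : ∀ x, F.mor (Mor.id x) = G.mor (Mor.id x) := fun x => by
    rw [F.mor_id, G.mor_id]; exact congrArg Mor.id (ho x.edges)
  have hc : ∀ {l : List (Edge n)} {e : Edge n} (_ : IsCell l e) (f : Mor (SimplexMon.{u} n))
      (_ : f.src = ⟨l⟩) (_ : f.tgt = ⟨[e]⟩), F.mor f = G.mor f := fun {l e} p => by
    induction p with
    | id e =>
      intro f h₁ h₂
      have : f = Mor.id ⟨[e]⟩ := Mor.ext_of_subsingleton h₁ h₂
      rw [this, hid]
    | @cons i j k s t l p ih =>
      intro f h₁ h₂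
      let g : (⟨l⟩ : SimplexMon.{u} n) ⟶ ⟨[⟨i, j, s⟩]⟩ :=
        SimplexMonHom.mk [l] (by simp) (.cons p .nil)
      have hs : (Mor.id (⟨[⟨j, k, t⟩]⟩ : SimplexMon.{u} n) * ⟨g⟩).tgt =
          ((gen.{u} n).tri s.le t.le).src := by
        rw [src_tri, edge_gen, edge_gen, edgeList_of_lt s, edgeList_of_lt t]
        rfl
      -- A cell factors as the cell of the shorter path, tensored with the last edge, followed by
      -- the triangle on `i < j < k`.
      have : f = (Mor.id ⟨[⟨j, k, t⟩]⟩ * ⟨g⟩ : Mor (SimplexMon.{u} n)).comp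
          ((gen.{u} n).tri s.le t.le) := by
        refine Mor.ext_of_subsingleton (h₁.trans ?_) (h₂.trans ?_)
        · rw [Mor.src_comp]; rfl
        · rw [Mor.tgt_comp hs, tgt_tri, edge_gen, edgeList_of_lt]
      rw [this, F.mor_comp hs, G.mor_comp hs, F.mor_mul, G.mor_mul, hid, ih ⟨g⟩ rfl rfl]
      exact congrArg _ (congrArg (fun S => S.tri s.le t.le) h)
  have hl : ∀ {d : List (List (Edge n))} {b : List (Edge n)} (_ : List.Forall₂ IsCell d b)
      (f : Mor (SimplexMon.{u} n)) (_ : f.src = ⟨d.flatten⟩) (_ : f.tgt = ⟨b⟩),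
      F.mor f = G.mor f := fun {d b} p => by
    induction p with
    | nil =>
      intro f h₁ h₂
      have : f = Mor.id ⟨[]⟩ := Mor.ext_of_subsingleton h₁ h₂
      rw [this, hid]
    | @cons l e d b p q ih =>
      intro f h₁ h₂
      let g : (⟨l⟩ : SimplexMon.{u} n) ⟶ ⟨[e]⟩ := SimplexMonHom.mk [l] (by simp) (.cons p .nil)
      let g' : (⟨d.flatten⟩ : SimplexMon.{u} n) ⟶ ⟨b⟩ := SimplexMonHom.mk d rfl q
      have : f = (⟨g⟩ * ⟨g'⟩ : Mor (SimplexMon.{u} n)) := Mor.ext_of_subsingleton h₁ h₂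
      rw [this, F.mor_mul, G.mor_mul, hc p ⟨g⟩ rfl rfl, ih ⟨g'⟩ rfl rfl]
  exact StrictMonoidalFunctor.ext_mor fun f =>
    hl (SimplexMonHom.cells f.hom) f (SimplexMon.ext (SimplexMonHom.flatten_eq f.hom).symm) rfl

theorem bijective_gen (n : ℕ) (M : Type u) [Category.{u} M] [MonoidalCategory M]
    [StrictMonoidal M] :
    Function.Bijective fun F : StrictMonoidalFunctor (SimplexMon.{u} n) M => (gen.{u} n).map F :=
  ⟨fun _ _ h => gen_hom_ext h, fun S => ⟨S.evalFunctor, S.map_evalFunctor_gen⟩⟩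

/-- The target is thin, so the two simplices agree as soon as their edges do. -/
theorem map_simplexMonMap_gen {n m : ℕ} (f : Fin (n + 1) →o Fin (m + 1)) :
    (gen.{u} n).map (simplexMonMap f) = (gen.{u} m).restrict f := by
  have he : ∀ {i j : Fin (n + 1)} (h : i ≤ j),
      ((gen.{u} n).map (simplexMonMap f)).edge h = ((gen.{u} m).restrict f).edge h :=
    fun h => SimplexMon.ext (mapEdges_edgeList f h)
  refine ext_tri fun i j k h h' => Mor.ext_of_subsingleton ?_ ?_
  · rw [src_tri, src_tri, he, he]
  · rw [tgt_tri, tgt_tri, he]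

end MorSimplex

theorem bijective_genPsi (n : SimplexCategory.Truncated 3) (M : StrMonCat.{u}) :
    Function.Bijective fun F : PhiZero.{u}.obj n ⟶ M =>
      (Psi.map F).app (Opposite.op n) (genPsi n) := by
  have h := MorSimplex.bijective_gen.{u} n.obj.len M.carrier
  -- Bijectivity may be tested after composing with the bijection `nlaxEquiv`.
  refine (Function.Bijective.of_comp_iff' (MorSimplex.nlaxEquiv
    (I := Fin (n.obj.len + 1)) (M := M.carrier)).bijective _).1 ?_
  exact Eq.subst (motive := Function.Bijective)
    (funext fun F => (MorSimplex.nlaxEquiv_map F (genSimplex.{u} n.obj.len)).symm) h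

theorem map_genPsi {n m : SimplexCategory.Truncated 3} (f : n ⟶ m) :
    (Psi.map (PhiZero.{u}.map f)).app (Opposite.op n) (genPsi n) =
      (Psi.obj (PhiZero.obj m)).map f.op (genPsi m) := by
  apply (MorSimplex.nlaxEquiv
    (I := Fin (n.obj.len + 1)) (M := SimplexMon.{u} m.obj.len)).injective
  refine (MorSimplex.nlaxEquiv_map (simplexMonMap f.hom.toOrderHom) _).trans ?_
  refine Eq.trans ?_ (MorSimplex.nlaxEquiv_restrict f.hom.toOrderHom _).symm
  exact MorSimplex.map_simplexMonMap_gen f.hom.toOrderHom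

end FreeSimplex

/-! ### Gluing simplices from dimensions at most 3 -/

section Glue

open MonoidalCategory Opposite

section Maps

variable {I J : Type} [Preorder I] [Preorder J]

/-- The edge of a preorder with given vertices. -/
def edgeMap {i j : I} (h : i ≤ j) : Fin 2 →o I :=
  ⟨![i, j], Fin.monotone_iff_le_succ.2 fun a => by fin_cases a; exact h⟩

/-- The triangle of a preorder with given vertices. -/
def triMap {i j k : I} (h : i ≤ j) (h' : j ≤ k) : Fin 3 →o I :=
  ⟨![i, j, k], Fin.monotone_iff_le_succ.2 fun a => by fin_cases a; exacts [h, h']⟩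

/-- The tetrahedron of a preorder with given vertices. -/
def tetMap {i j k l : I} (h : i ≤ j) (h' : j ≤ k) (h'' : k ≤ l) : Fin 4 →o I :=
  ⟨![i, j, k, l], Fin.monotone_iff_le_succ.2 fun a => by fin_cases a; exacts [h, h', h'']⟩

theorem comp_edgeMap (f : I →o J) {i j : I} (h : i ≤ j) :
    f.comp (edgeMap h) = edgeMap (f.monotone h) := by
  ext a : 2
  fin_cases a <;> rfl

theorem comp_triMap (f : I →o J) {i j k : I} (h : i ≤ j) (h' : j ≤ k) :
    f.comp (triMap h h') = triMap (f.monotone h) (f.monotone h') := by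
  ext a : 2
  fin_cases a <;> rfl

end Maps

namespace MorSimplex

variable {I J : Type} [Preorder I] [Preorder J] {M : Type u} [Category.{v} M]
  [MonoidalCategory M] [StrictMonoidal M]

/-- A compatible family of simplices of dimension at most 3, indexed by the simplices of a
preorder. -/
structure Family (I : Type) [Preorder I] (M : Type u) [Category.{v} M] [MonoidalCategory M]
    [StrictMonoidal M] where
  simplex : ∀ {k : ℕ}, k ≤ 3 → (Fin (k + 1) →o I) → MorSimplex (Fin (k + 1)) M
  restrict : ∀ {k m : ℕ} (hk : k ≤ 3) (hm : m ≤ 3) (f : Fin (k + 1) →o Fin (m + 1))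
    (g : Fin (m + 1) →o I), simplex hk (g.comp f) = (simplex hm g).restrict f

namespace Family

variable (T : Family I M)

/-- The edges of a compatible family. -/
def edge {i j : I} (h : i ≤ j) : M :=
  (T.simplex (k := 1) (by decide) (edgeMap h)).edge (i := 0) (j := 1) (by decide)

/-- The triangles of a compatible family. -/
def tri {i j k : I} (h : i ≤ j) (h' : j ≤ k) : Mor M :=
  (T.simplex (k := 2) (by decide) (triMap h h')).tri (i := 0) (j := 1) (k := 2) (by decide)
    (by decide)

/-- Restricting a member of the family to one of its edges gives the 1-simplex with the same end
points in `I`. Hence that edge depends on the end points alone, not on the member. -/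
theorem edge_map {m : ℕ} (hm : m ≤ 3) (g : Fin (m + 1) →o I) {i j : Fin (m + 1)} (h : i ≤ j) :
    T.edge (g.monotone h) = (T.simplex hm g).edge h := by
  rw [edge, ← comp_edgeMap g h, T.restrict _ hm]
  rfl

theorem tri_map {m : ℕ} (hm : m ≤ 3) (g : Fin (m + 1) →o I) {i j k : Fin (m + 1)} (h : i ≤ j)
    (h' : j ≤ k) : T.tri (g.monotone h) (g.monotone h') = (T.simplex hm g).tri h h' := by
  rw [tri, ← comp_triMap g h h', T.restrict _ hm]
  rfl

/-- The simplex that is glued from a compatible family. -/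
def glue : MorSimplex I M where
  edge h := T.edge h
  tri h h' := T.tri h h'
  src_tri h h' := (src_tri _ _ _).trans (congrArg₂ (fun a b : M => a ⊗ b)
    (T.edge_map (m := 2) (by decide) (triMap h h') (i := 1) (j := 2) (by decide))
    (T.edge_map (m := 2) (by decide) (triMap h h') (i := 0) (j := 1) (by decide))).symm
  tgt_tri h h' := (tgt_tri _ _ _).trans
    (T.edge_map (m := 2) (by decide) (triMap h h') (i := 0) (j := 2) (by decide)).symm
  -- Normalisation is read off the degenerate edges and triangles of the 1-simplices of the family.
  edge_self i := (T.edge_map (m := 1) (by decide) (edgeMap (le_refl i)) (i := 0) (j := 0)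
    le_rfl).trans (edge_self _ _)
  tri_left h := (T.tri_map (m := 1) (by decide) (edgeMap h) (i := 0) (j := 0) (k := 1) le_rfl
    (by decide)).trans (tri_left _ _)
  tri_right h := (T.tri_map (m := 1) (by decide) (edgeMap h) (i := 0) (j := 1) (k := 1)
    (by decide) le_rfl).trans (tri_right _ _)
  assoc h h' h'' := by
    -- All edges and triangles in the equation belong to the single 3-simplex on `i ≤ j ≤ k ≤ l`,
    -- where it holds.
    have he := fun {i j} => T.edge_map (m := 3) (by decide) (tetMap h h' h'') (i := i) (j := j)
    have ht := fun {i j k} =>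
      T.tri_map (m := 3) (by decide) (tetMap h h' h'') (i := i) (j := j) (k := k)
    have h₁ : T.edge h = _ := he (i := 0) (j := 1) (by decide)
    have h₂ : T.edge h'' = _ := he (i := 2) (j := 3) (by decide)
    have h₃ : T.tri h h' = _ := ht (i := 0) (j := 1) (k := 2) (by decide) (by decide)
    have h₄ : T.tri (h.trans h') h'' = _ :=
      ht (i := 0) (j := 2) (k := 3) (by decide) (by decide)
    have h₅ : T.tri h' h'' = _ := ht (i := 1) (j := 2) (k := 3) (by decide) (by decide)
    have h₆ : T.tri h (h'.trans h'') = _ :=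
      ht (i := 0) (j := 1) (k := 3) (by decide) (by decide)
    rw [h₁, h₂, h₃, h₄, h₅, h₆]
    exact assoc _ _ _ _

theorem glue_restrict {m : ℕ} (hm : m ≤ 3) (g : Fin (m + 1) →o I) :
    T.glue.restrict g = T.simplex hm g :=
  ext_tri fun _ _ _ h h' => T.tri_map hm g h h'

end Family

/-- Triangles determine a simplex, hence so do its 2-dimensional restrictions. -/
theorem ext_restrict {S T : MorSimplex I M}
    (h : ∀ f : Fin 3 →o I, S.restrict f = T.restrict f) : S = T :=
  ext_tri fun _ _ _ p q => congrArg (fun S : MorSimplex (Fin 3) M =>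
    S.tri (i := 0) (j := 1) (k := 2) (by decide) (by decide)) (h (triMap p q))

end MorSimplex

end Glue

/-! ### The nerve of `BM` is 3-coskeletal -/

section Coskeletal

open Opposite MorSimplex

variable (M : StrMonCat.{u})

/-- The simplices of the nerve of `BM` in terms of objects and morphisms of `M`. -/
def nerveEquiv (n : SimplexCategoryᵒᵖ) :
    (nerveDeloop.obj M).obj n ≃ MorSimplex (Fin (n.unop.len + 1)) M.carrier :=
  nlaxEquiv

variable {M}

theorem nerveEquiv_map {n m : SimplexCategoryᵒᵖ} (f : n ⟶ m) (x : (nerveDeloop.obj M).obj n) :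
    nerveEquiv M m ((nerveDeloop.obj M).map f x) =
      (nerveEquiv M n x).restrict f.unop.toOrderHom :=
  nlaxEquiv_restrict _ _

theorem nerveEquiv_app {N : StrMonCat.{u}} (F : M ⟶ N) {n : SimplexCategoryᵒᵖ}
    (x : (nerveDeloop.obj M).obj n) :
    nerveEquiv N n ((nerveDeloop.map F).app n x) = (nerveEquiv M n x).map F :=
  nlaxEquiv_map _ _

variable {G : SSet.{u}} (φ : (SSet.truncation 3).obj G ⟶ Psi.obj M)

/-- The truncated simplex category has an object for every natural number that is at most 3. -/
abbrev truncMk {k : ℕ} (hk : k ≤ 3) : SimplexCategory.Truncated 3 :=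
  ⟨SimplexCategory.mk k, hk⟩

/-- A monotone map as a morphism of the simplex category. -/
abbrev ordHom {k m : ℕ} (f : Fin (k + 1) →o Fin (m + 1)) :
    SimplexCategory.mk k ⟶ SimplexCategory.mk m :=
  SimplexCategory.Hom.mk f

/-- A monotone map as a morphism of the truncated simplex category. -/
abbrev truncHom {k m : ℕ} (hk : k ≤ 3) (hm : m ≤ 3) (f : Fin (k + 1) →o Fin (m + 1)) :
    truncMk hk ⟶ truncMk hm :=
  ObjectProperty.homMk (ordHom f)

/-- The compatible family of simplices that comes from a map of truncations. -/
def familyOfTruncation {n : SimplexCategoryᵒᵖ} (x : G.obj n) :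
    Family (Fin (n.unop.len + 1)) M.carrier where
  simplex {k} hk g := nerveEquiv M (op (SimplexCategory.mk k))
    (φ.app (op (truncMk hk)) (G.map (Quiver.Hom.op (Y := n.unop) (ordHom g)) x))
  restrict {k m} hk hm f g := by
    have h := NatTrans.naturality_apply φ (truncHom hk hm f).op
      (G.map (Quiver.Hom.op (Y := n.unop) (ordHom g)) x)
    have h' : G.map (Quiver.Hom.op (Y := n.unop) (ordHom (g.comp f))) x =
        G.map (ordHom f).op (G.map (Quiver.Hom.op (Y := n.unop) (ordHom g)) x) :=
      ConcreteCategory.congr_hom (G.map_comp (Quiver.Hom.op (Y := n.unop) (ordHom g))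
        (ordHom f).op) x
    rw [h']
    exact (congrArg (nerveEquiv M (op (SimplexCategory.mk k))) h).trans
      (nerveEquiv_map (ordHom f).op _)

theorem familyOfTruncation_map {n m : SimplexCategoryᵒᵖ} (f : n ⟶ m) (x : G.obj n) {k : ℕ}
    (hk : k ≤ 3) (g : Fin (k + 1) →o Fin (m.unop.len + 1)) :
    (familyOfTruncation φ (G.map f x)).simplex hk g =
      (familyOfTruncation φ x).simplex hk (f.unop.toOrderHom.comp g) :=
  congrArg (fun y => nerveEquiv M (op (SimplexCategory.mk k)) (φ.app (op (truncMk hk)) y))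
    (ConcreteCategory.congr_hom (G.map_comp f (Quiver.Hom.op (Y := m.unop) (ordHom g))) x).symm

/-- The extension of a map of truncations to a map into the nerve of `BM`. -/
def extendTruncation : G ⟶ nerveDeloop.obj M where
  app n := TypeCat.ofHom fun x => (nerveEquiv M n).symm (familyOfTruncation φ x).glue
  naturality n m f := by
    ext x
    apply (nerveEquiv M m).injective
    refine ((nerveEquiv M m).apply_symm_apply _).trans ?_
    refine Eq.trans ?_ (nerveEquiv_map f _).symm
    refine Eq.trans ?_ (congrArg (MorSimplex.restrict f.unop.toOrderHom)
      ((nerveEquiv M n).apply_symm_apply _)).symm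
    -- On a 2-dimensional restriction both glued simplices reduce to members of the family of `x`,
    -- indexed by the same composite map.
    refine ext_restrict fun g => ?_
    rw [Family.glue_restrict _ (by decide) g]
    refine (familyOfTruncation_map φ f x _ g).trans ?_
    exact (Family.glue_restrict _ (by decide) (f.unop.toOrderHom.comp g)).symm

theorem truncation_extendTruncation :
    (SSet.truncation 3).map (extendTruncation φ) = φ := by
  ext n x
  apply (nerveEquiv M (op n.unop.obj)).injective
  refine ((nerveEquiv M (op n.unop.obj)).apply_symm_apply
    (familyOfTruncation φ (n := op n.unop.obj) x).glue).trans ?_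
  -- In dimension at most 3 the identity of the ordinal indexes a member of the family, and that
  -- member is the glued simplex itself.
  refine ((familyOfTruncation φ (n := op n.unop.obj) x).glue_restrict
    n.unop.property OrderHom.id).trans ?_
  have : G.map (Quiver.Hom.op (Y := n.unop.obj) (ordHom OrderHom.id)) x = x :=
    ConcreteCategory.congr_hom (G.map_id (op n.unop.obj)) x
  exact congrArg (fun x => nerveEquiv M (op n.unop.obj) (φ.app n x)) this

/-- By naturality and `ext_restrict`, a map into the nerve is determined by what it does to
2-simplices. -/
theorem truncation_hom_ext {α β : G ⟶ nerveDeloop.obj M}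
    (h : (SSet.truncation 3).map α = (SSet.truncation 3).map β) : α = β := by
  ext n x
  apply (nerveEquiv M n).injective
  refine ext_restrict (I := Fin (n.unop.len + 1)) (M := M.carrier) fun f => ?_
  let g : n ⟶ op (SimplexCategory.mk 2) := Quiver.Hom.op (Y := n.unop) (ordHom f)
  refine (nerveEquiv_map g _).symm.trans (Eq.trans ?_ (nerveEquiv_map g _))
  refine congrArg (nerveEquiv M (op (SimplexCategory.mk 2))) ?_
  refine (NatTrans.naturality_apply α g x).symm.trans
    (Eq.trans ?_ (NatTrans.naturality_apply β g x))
  exact congrArg (fun γ => γ.app (op (truncMk (k := 2) (by decide))) (G.map g x)) h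

/-- A right Kan extension is a terminal object among the pairs of a simplicial set `G` and a map
from its truncation to `Ψ M`; existence of the comparison is gluing, uniqueness is
`truncation_hom_ext`. -/
theorem isCoskeletal_nerveDeloop (M : StrMonCat.{u}) : (nerveDeloop.obj M).IsCoskeletal 3 where
  isRightKanExtension := ⟨⟨Limits.IsTerminal.ofUniqueHom
    (fun E => CostructuredArrow.homMk (extendTruncation (M := M) E.hom)
      ((Category.comp_id _).trans (truncation_extendTruncation (M := M) E.hom)))
    (fun E m => CostructuredArrow.hom_ext _ _ (truncation_hom_ext
      (((Category.comp_id _).symm.trans (CostructuredArrow.w m)).trans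
        (truncation_extendTruncation (M := M) E.hom).symm)))⟩⟩

end Coskeletal

/-! ### The free strict monoidal category on a 3-truncated simplicial set -/

section FreeMon

open MonoidalCategory Opposite

variable {X : SSet.Truncated.{u} 3}

/-- The simplex of `M` that is the image of a simplex under a map into `Ψ M`. -/
def imageSimplex {M : StrMonCat.{u}} (φ : X ⟶ Psi.obj M) {n : SimplexCategory.Truncated 3}
    (x : X.obj (op n)) : MorSimplex (Fin (n.obj.len + 1)) M.carrier :=
  nerveEquiv M (op n.obj) (φ.app (op n) x)

theorem imageSimplex_map {M : StrMonCat.{u}} (φ : X ⟶ Psi.obj M)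
    {n m : SimplexCategory.Truncated 3} (f : m ⟶ n) (x : X.obj (op n)) :
    imageSimplex φ (X.map f.op x) = (imageSimplex φ x).restrict f.hom.toOrderHom :=
  (congrArg (nerveEquiv M (op m.obj)) (NatTrans.naturality_apply φ f.op x)).trans
    (nerveEquiv_map f.hom.op _)

theorem imageSimplex_comp {M N : StrMonCat.{u}} (φ : X ⟶ Psi.obj M) (F : M ⟶ N)
    {n : SimplexCategory.Truncated 3} (x : X.obj (op n)) :
    imageSimplex (φ ≫ Psi.map F) x = (imageSimplex φ x).map F :=
  nerveEquiv_app F _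

theorem hom_ext_imageSimplex {M : StrMonCat.{u}} {φ ψ : X ⟶ Psi.obj M}
    (h : ∀ (n : SimplexCategory.Truncated 3) (x : X.obj (op n)),
      imageSimplex φ x = imageSimplex ψ x) : φ = ψ := by
  ext n x
  exact (nerveEquiv M (op n.unop.obj)).injective (h n.unop x)

/-- An edge of a simplex of `X`. -/
structure EdgeGen (X : SSet.Truncated.{u} 3) : Type u where
  {dim : SimplexCategory.Truncated 3}
  simplex : X.obj (op dim)
  {src : Fin (dim.obj.len + 1)}
  {tgt : Fin (dim.obj.len + 1)}
  le : src ≤ tgt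

/-- The value of a word of edges under a map into `Ψ M`. -/
def evalWord {M : StrMonCat.{u}} (φ : X ⟶ Psi.obj M) (w : List (EdgeGen X)) : M.carrier :=
  w.foldr (fun e x => (imageSimplex φ e.simplex).edge e.le ⊗ x) (𝟙_ _)

theorem evalWord_append {M : StrMonCat.{u}} (φ : X ⟶ Psi.obj M) (w w' : List (EdgeGen X)) :
    evalWord φ (w ++ w') = evalWord φ w ⊗ evalWord φ w' := by
  induction w with
  | nil => exact (StrictMonoidal.unit_tensor _).symm
  | cons e w ih =>
    exact (congrArg (fun t => (imageSimplex φ e.simplex).edge e.le ⊗ t) ih).trans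
      (StrictMonoidal.tensor_assoc _ _ _).symm

/-- Words are identified if they have the same value under all maps into some `Ψ M`. -/
def wordSetoid (X : SSet.Truncated.{u} 3) : Setoid (List (EdgeGen X)) where
  r w w' := ∀ (M : StrMonCat.{u}) (φ : X ⟶ Psi.obj M), evalWord φ w = evalWord φ w'
  iseqv := ⟨fun _ _ _ => rfl, fun h M φ => (h M φ).symm, fun h h' M φ => (h M φ).trans (h' M φ)⟩

/-- The objects of the free strict monoidal category on a truncated simplicial set. -/
def FreeMon (X : SSet.Truncated.{u} 3) : Type u := Quotient (wordSetoid X)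

namespace FreeMon

/-- The object that is given by an edge of a simplex. -/
def edge {n : SimplexCategory.Truncated 3} (x : X.obj (op n)) {i j : Fin (n.obj.len + 1)}
    (h : i ≤ j) : FreeMon X :=
  Quotient.mk _ [⟨x, h⟩]

/-- The empty word. -/
def unit : FreeMon X := Quotient.mk _ []

/-- The concatenation of words. -/
def tensor : FreeMon X → FreeMon X → FreeMon X :=
  Quotient.map₂ (· ++ ·) fun _ _ h _ _ h' M φ =>
    (evalWord_append φ _ _).trans
      ((congrArg₂ (fun a b => a ⊗ b) (h M φ) (h' M φ)).trans (evalWord_append φ _ _).symm)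

section

variable {M : StrMonCat.{u}} (φ : X ⟶ Psi.obj M)

/-- The value of an object under a map into `Ψ M`. -/
def evalObj : FreeMon X → M.carrier := Quotient.lift (evalWord φ) fun _ _ h => h M φ

theorem evalObj_edge {n : SimplexCategory.Truncated 3} (x : X.obj (op n))
    {i j : Fin (n.obj.len + 1)} (h : i ≤ j) :
    evalObj φ (edge x h) = (imageSimplex φ x).edge h :=
  StrictMonoidal.tensor_unit _

theorem evalObj_unit : evalObj φ unit = 𝟙_ _ := rfl

theorem evalObj_tensor (a b : FreeMon X) :
    evalObj φ (tensor a b) = evalObj φ a ⊗ evalObj φ b := by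
  induction a using Quotient.inductionOn
  induction b using Quotient.inductionOn
  exact evalWord_append φ _ _

end

/-- The evaluations are jointly injective by construction of the quotient, so an equation between
objects is checked by computing in an arbitrary `M`. -/
theorem ext_evalObj {a b : FreeMon X}
    (h : ∀ (M : StrMonCat.{u}) (φ : X ⟶ Psi.obj M), evalObj φ a = evalObj φ b) : a = b := by
  induction a using Quotient.inductionOn
  induction b using Quotient.inductionOn
  exact Quotient.sound h

/-- Formal composites and tensor products of the triangles of `X`. -/
inductive PreHom : FreeMon X → FreeMon X → Type u
  | id (a : FreeMon X) : PreHom a a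
  -- The middle object is a class of words, so formal morphisms compose even when their ends agree
  -- only after identification, as with faces shared between simplices or degenerate edges.
  | comp {a b c : FreeMon X} : PreHom a b → PreHom b c → PreHom a c
  | tensor {a b c d : FreeMon X} : PreHom a b → PreHom c d → PreHom (tensor a c) (tensor b d)
  | tri {n : SimplexCategory.Truncated 3} (x : X.obj (op n)) {i j k : Fin (n.obj.len + 1)}
      (h : i ≤ j) (h' : j ≤ k) :
      PreHom (FreeMon.tensor (edge x h') (edge x h)) (edge x (h.trans h'))

namespace PreHom

variable {M : StrMonCat.{u}} (φ : X ⟶ Psi.obj M)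

/-- The value of a formal morphism under a map into `Ψ M`. -/
noncomputable def eval : ∀ {a b : FreeMon X}, PreHom a b → Mor M.carrier
  | _, _, id a => Mor.id (evalObj φ a)
  | _, _, comp f g => (eval f).comp (eval g)
  | _, _, tensor f g => eval f * eval g
  | _, _, tri x h h' => (imageSimplex φ x).tri h h'

/-- Both ends are handled in one induction: the target of a composite is the expected one only if
the two values are composable. -/
theorem src_tgt_eval {a b : FreeMon X} (f : PreHom a b) :
    (eval φ f).src = evalObj φ a ∧ (eval φ f).tgt = evalObj φ b := by
  induction f with
  | id a => exact ⟨rfl, rfl⟩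
  | comp f g ih ih' =>
    exact ⟨(Mor.src_comp _ _).trans ih.1, (Mor.tgt_comp (ih.2.trans ih'.1.symm)).trans ih'.2⟩
  | tensor f g ih ih' =>
    rw [evalObj_tensor, evalObj_tensor, ← ih.1, ← ih.2, ← ih'.1, ← ih'.2]
    exact ⟨rfl, rfl⟩
  | tri x h h' =>
    rw [evalObj_tensor, evalObj_edge, evalObj_edge, evalObj_edge]
    exact ⟨MorSimplex.src_tri _ _ _, MorSimplex.tgt_tri _ _ _⟩

/-- Formal morphisms are identified if they have the same value under all maps into some `Ψ M`. -/
instance setoid (a b : FreeMon X) : Setoid (PreHom a b) where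
  r f g := ∀ (M : StrMonCat.{u}) (φ : X ⟶ Psi.obj M), eval φ f = eval φ g
  iseqv := ⟨fun _ _ _ => rfl, fun h M φ => (h M φ).symm, fun h h' M φ => (h M φ).trans (h' M φ)⟩

end PreHom

/-- The morphisms of the free strict monoidal category on a truncated simplicial set. -/
def Hom (a b : FreeMon X) : Type u := Quotient (PreHom.setoid a b)

/-- The value of a morphism under a map into `Ψ M`. -/
noncomputable def evalHom {M : StrMonCat.{u}} (φ : X ⟶ Psi.obj M) {a b : FreeMon X}
    (f : Hom a b) : Mor M.carrier :=
  Quotient.lift (s := PreHom.setoid a b) (PreHom.eval φ) (fun _ _ h => h M φ) f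

theorem ext_evalHom {a b : FreeMon X} {f g : Hom a b}
    (h : ∀ (M : StrMonCat.{u}) (φ : X ⟶ Psi.obj M), evalHom φ f = evalHom φ g) : f = g := by
  induction f using Quotient.inductionOn
  induction g using Quotient.inductionOn
  exact Quotient.sound h

/-- The tensor product of morphisms. -/
def tensorHom {a b c d : FreeMon X} :
    Hom a b → Hom c d → Hom (tensor a c) (tensor b d) :=
  Quotient.map₂ PreHom.tensor fun _ _ h _ _ h' M φ =>
    congrArg₂ (fun a b => a * b) (h M φ) (h' M φ)

@[simp]
theorem src_evalHom {M : StrMonCat.{u}} (φ : X ⟶ Psi.obj M) {a b : FreeMon X}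
    (f : Hom a b) : (evalHom φ f).src = evalObj φ a := by
  induction f using Quotient.inductionOn
  exact (PreHom.src_tgt_eval φ _).1

@[simp]
theorem tgt_evalHom {M : StrMonCat.{u}} (φ : X ⟶ Psi.obj M) {a b : FreeMon X}
    (f : Hom a b) : (evalHom φ f).tgt = evalObj φ b := by
  induction f using Quotient.inductionOn
  exact (PreHom.src_tgt_eval φ _).2

/-- The composition of morphisms. -/
def compHom {a b c : FreeMon X} : Hom a b → Hom b c → Hom a c :=
  Quotient.map₂ PreHom.comp fun _ _ h _ _ h' M φ => congrArg₂ Mor.comp (h M φ) (h' M φ)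

theorem evalHom_compHom {M : StrMonCat.{u}} (φ : X ⟶ Psi.obj M) {a b c : FreeMon X}
    (f : Hom a b) (g : Hom b c) :
    evalHom φ (compHom f g) = (evalHom φ f).comp (evalHom φ g) := by
  induction f using Quotient.inductionOn
  induction g using Quotient.inductionOn
  rfl

theorem evalHom_tensorHom {M : StrMonCat.{u}} (φ : X ⟶ Psi.obj M) {a b c d : FreeMon X}
    (f : Hom a b) (g : Hom c d) :
    evalHom φ (tensorHom f g) = evalHom φ f * evalHom φ g := by
  induction f using Quotient.inductionOn
  induction g using Quotient.inductionOn
  rfl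

instance : Category.{u} (FreeMon X) where
  Hom a b := Hom a b
  id a := Quotient.mk _ (PreHom.id a)
  comp f g := compHom f g
  id_comp f := ext_evalHom fun M φ => (evalHom_compHom φ _ _).trans
    (Mor.id_comp (src_evalHom φ f))
  comp_id f := ext_evalHom fun M φ => (evalHom_compHom φ _ _).trans
    (Mor.comp_id (tgt_evalHom φ f))
  assoc f g h := ext_evalHom fun M φ => by
    simp only [evalHom_compHom]
    exact Mor.comp_assoc (by simp) (by simp)

section

variable {M : StrMonCat.{u}} (φ : X ⟶ Psi.obj M)

theorem evalHom_id (a : FreeMon X) : evalHom φ (𝟙 a) = Mor.id (evalObj φ a) := rfl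

theorem evalHom_eqToHom {a b : FreeMon X} (h : a = b) :
    evalHom φ (eqToHom h) = Mor.id (evalObj φ a) := by
  subst h; rfl

theorem evalHom_comp {a b c : FreeMon X} (f : a ⟶ b) (g : b ⟶ c) :
    evalHom φ (f ≫ g) = (evalHom φ f).comp (evalHom φ g) :=
  evalHom_compHom φ f g

end

theorem tensor_assoc (a b c : FreeMon X) : tensor (tensor a b) c = tensor a (tensor b c) :=
  ext_evalObj fun M φ => by
    simp only [evalObj_tensor, StrictMonoidal.tensor_assoc]

theorem unit_tensor (a : FreeMon X) : tensor unit a = a :=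
  ext_evalObj fun M φ => by
    simp only [evalObj_tensor, evalObj_unit, StrictMonoidal.unit_tensor]

theorem tensor_unit (a : FreeMon X) : tensor a unit = a :=
  ext_evalObj fun M φ => by
    simp only [evalObj_tensor, evalObj_unit, StrictMonoidal.tensor_unit]

/-- The morphism that is represented by a formal morphism. -/
def PreHom.toHom {a b : FreeMon X} (f : PreHom a b) : a ⟶ b := Quotient.mk _ f

instance : MonoidalCategoryStruct (FreeMon X) where
  tensorObj a b := tensor a b
  tensorUnit := unit
  tensorHom f g := tensorHom f g
  whiskerLeft a _ _ f := tensorHom (𝟙 a) f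
  whiskerRight f a := tensorHom f (𝟙 a)
  associator a b c := eqToIso (tensor_assoc a b c)
  leftUnitor a := eqToIso (unit_tensor a)
  rightUnitor a := eqToIso (tensor_unit a)

section

variable {M : StrMonCat.{u}} (φ : X ⟶ Psi.obj M)

theorem evalObj_tensorObj (a b : FreeMon X) : evalObj φ (a ⊗ b) = evalObj φ a ⊗ evalObj φ b :=
  evalObj_tensor φ a b

theorem evalObj_tensorUnit : evalObj φ (𝟙_ (FreeMon X)) = 𝟙_ M.carrier := rfl

theorem evalHom_monoidalTensorHom {a b c d : FreeMon X} (f : a ⟶ b) (g : c ⟶ d) :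
    evalHom φ (f ⊗ₘ g) = evalHom φ f * evalHom φ g :=
  evalHom_tensorHom φ f g

theorem evalHom_whiskerLeft (a : FreeMon X) {b c : FreeMon X} (f : b ⟶ c) :
    evalHom φ (a ◁ f) = Mor.id (evalObj φ a) * evalHom φ f :=
  evalHom_tensorHom φ (𝟙 a) f

theorem evalHom_whiskerRight {b c : FreeMon X} (f : b ⟶ c) (a : FreeMon X) :
    evalHom φ (f ▷ a) = evalHom φ f * Mor.id (evalObj φ a) :=
  evalHom_tensorHom φ f (𝟙 a)

theorem evalHom_associator (a b c : FreeMon X) :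
    evalHom φ (α_ a b c).hom =
      Mor.id (evalObj φ a) * Mor.id (evalObj φ b) * Mor.id (evalObj φ c) := by
  refine (evalHom_eqToHom φ (tensor_assoc a b c)).trans ?_
  rw [evalObj_tensor, evalObj_tensor, Mor.id_tensor, Mor.id_tensor]

theorem evalHom_leftUnitor (a : FreeMon X) :
    evalHom φ (λ_ a).hom = Mor.id (evalObj φ a) := by
  exact (evalHom_eqToHom φ (unit_tensor a)).trans (congrArg _ (congrArg _ (unit_tensor a)))

theorem evalHom_rightUnitor (a : FreeMon X) :
    evalHom φ (ρ_ a).hom = Mor.id (evalObj φ a) := by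
  exact (evalHom_eqToHom φ (tensor_unit a)).trans (congrArg _ (congrArg _ (tensor_unit a)))

end

/-- Every axiom is evaluated in an arbitrary `M`; the associators and unitors evaluate to identities
there, and what remains is a law of `Mor`. -/
instance : MonoidalCategory (FreeMon X) where
  tensorHom_def f g := ext_evalHom fun M φ => by
    simp only [evalHom_monoidalTensorHom, evalHom_comp, evalHom_whiskerLeft, evalHom_whiskerRight]
    rw [← Mor.comp_mul_comp (by simp) (by simp), Mor.comp_id (by simp), Mor.id_comp (by simp)]
  id_tensorHom_id a b := ext_evalHom fun M φ => by
    simp only [evalHom_monoidalTensorHom, evalHom_id, evalObj_tensorObj, Mor.id_tensor]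
  tensorHom_comp_tensorHom f f' g g' := ext_evalHom fun M φ => by
    simp only [evalHom_monoidalTensorHom, evalHom_comp]
    rw [← Mor.comp_mul_comp (by simp) (by simp)]
  whiskerLeft_id a b := ext_evalHom fun M φ => by
    simp only [evalHom_whiskerLeft, evalHom_id, evalObj_tensorObj, Mor.id_tensor]
  id_whiskerRight a b := ext_evalHom fun M φ => by
    simp only [evalHom_whiskerRight, evalHom_id, evalObj_tensorObj, Mor.id_tensor]
  associator_naturality f g h := ext_evalHom fun M φ => by
    simp only [evalHom_comp, evalHom_monoidalTensorHom, evalHom_associator, ← Mor.id_tensor]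
    rw [Mor.comp_id (by simp), Mor.id_comp (by simp [StrictMonoidal.tensor_assoc]), mul_assoc]
  leftUnitor_naturality f := ext_evalHom fun M φ => by
    simp only [evalHom_comp, evalHom_whiskerLeft, evalHom_leftUnitor, evalObj_tensorUnit,
      Mor.id_unit, one_mul]
    rw [Mor.comp_id (by simp), Mor.id_comp (by simp)]
  rightUnitor_naturality f := ext_evalHom fun M φ => by
    simp only [evalHom_comp, evalHom_whiskerRight, evalHom_rightUnitor, evalObj_tensorUnit,
      Mor.id_unit, mul_one]
    rw [Mor.comp_id (by simp), Mor.id_comp (by simp)]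
  pentagon a b c d := ext_evalHom fun M φ => by
    simp only [evalHom_comp, evalHom_whiskerRight, evalHom_whiskerLeft, evalHom_associator,
      evalObj_tensorObj, ← Mor.id_tensor, StrictMonoidal.tensor_assoc]
    simp
  triangle a b := ext_evalHom fun M φ => by
    simp only [evalHom_comp, evalHom_whiskerRight, evalHom_whiskerLeft, evalHom_associator,
      evalHom_leftUnitor, evalHom_rightUnitor, evalObj_tensorUnit,
      ← Mor.id_tensor, StrictMonoidal.tensor_assoc, StrictMonoidal.unit_tensor]
    exact Mor.id_comp rfl

instance : StrictMonoidal (FreeMon X) where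
  unit_tensor := unit_tensor
  tensor_unit := tensor_unit
  tensor_assoc := tensor_assoc
  leftUnitor_eq _ := rfl
  rightUnitor_eq _ := rfl
  associator_eq _ _ _ := rfl

/-- The strict monoidal functor that is determined by a map into `Ψ M`. -/
noncomputable def lift {M : StrMonCat.{u}} (φ : X ⟶ Psi.obj M) :
    StrictMonoidalFunctor (FreeMon X) M.carrier :=
  StrictMonoidalFunctor.ofMor (evalObj φ) (fun f => evalHom φ f.hom)
    (fun f => src_evalHom φ f.hom) (fun f => tgt_evalHom φ f.hom) (evalHom_id φ)
    (evalHom_comp φ) rfl (evalObj_tensor φ) (fun f g => evalHom_tensorHom φ f.hom g.hom)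

theorem mor_lift {M : StrMonCat.{u}} (φ : X ⟶ Psi.obj M) (f : Mor (FreeMon X)) :
    (lift φ).mor f = evalHom φ f.hom :=
  StrictMonoidalFunctor.mor_ofMor _ _ _ _ _ _ _ _ _ _

/-- The lifts are jointly injective also on bundled morphisms, since they detect the ends first. The
simplex laws of `unitSimplex` follow from those of its images. -/
theorem ext_lift {f g : Mor (FreeMon X)}
    (h : ∀ (M : StrMonCat.{u}) (φ : X ⟶ Psi.obj M), (lift φ).mor f = (lift φ).mor g) :
    f = g := by
  have hs : f.src = g.src := ext_evalObj fun M φ => congrArg Mor.src (h M φ)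
  have ht : f.tgt = g.tgt := ext_evalObj fun M φ => congrArg Mor.tgt (h M φ)
  obtain ⟨f⟩ := f
  obtain ⟨g⟩ := g
  dsimp only at hs ht
  subst hs ht
  refine congrArg Mor.mk (ext_evalHom fun M φ => ?_)
  have := h M φ
  rwa [mor_lift, mor_lift] at this

/-- The morphism that is given by a triangle of a simplex. -/
def tri {n : SimplexCategory.Truncated 3} (x : X.obj (op n)) {i j k : Fin (n.obj.len + 1)}
    (h : i ≤ j) (h' : j ≤ k) : (edge x h' ⊗ edge x h : FreeMon X) ⟶ edge x (h.trans h') :=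
  Quotient.mk _ (PreHom.tri x h h')

theorem mor_lift_tri {M : StrMonCat.{u}} (φ : X ⟶ Psi.obj M) {n : SimplexCategory.Truncated 3}
    (x : X.obj (op n)) {i j k : Fin (n.obj.len + 1)} (h : i ≤ j) (h' : j ≤ k) :
    (lift φ).mor ⟨tri x h h'⟩ = (imageSimplex φ x).tri h h' :=
  mor_lift φ _

theorem obj_lift_edge {M : StrMonCat.{u}} (φ : X ⟶ Psi.obj M) {n : SimplexCategory.Truncated 3}
    (x : X.obj (op n)) {i j : Fin (n.obj.len + 1)} (h : i ≤ j) :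
    (lift φ).obj (edge x h) = (imageSimplex φ x).edge h :=
  evalObj_edge φ x h

/-- The simplex of the free strict monoidal category that is given by a simplex of `X`. -/
def unitSimplex {n : SimplexCategory.Truncated 3} (x : X.obj (op n)) :
    MorSimplex (Fin (n.obj.len + 1)) (FreeMon X) where
  edge h := edge x h
  tri h h' := ⟨tri x h h'⟩
  src_tri _ _ := rfl
  tgt_tri _ _ := rfl
  -- A degenerate edge is a word of length one, but each evaluation sends it to the unit, so it
  -- equals the empty word.
  edge_self i := ext_evalObj fun M φ => (evalObj_edge φ x _).trans (MorSimplex.edge_self _ _)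
  tri_left h := ext_lift fun M φ => by
    rw [mor_lift_tri, StrictMonoidalFunctor.mor_id, obj_lift_edge, MorSimplex.tri_left]
  tri_right h := ext_lift fun M φ => by
    rw [mor_lift_tri, StrictMonoidalFunctor.mor_id, obj_lift_edge, MorSimplex.tri_right]
  assoc h h' h'' := ext_lift fun M φ => by
    rw [StrictMonoidalFunctor.mor_comp _ rfl, StrictMonoidalFunctor.mor_comp _ rfl]
    simp only [StrictMonoidalFunctor.mor_mul, StrictMonoidalFunctor.mor_id, mor_lift_tri,
      obj_lift_edge]
    exact MorSimplex.assoc _ h h' h''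

theorem unitSimplex_lift {M : StrMonCat.{u}} (φ : X ⟶ Psi.obj M)
    {n : SimplexCategory.Truncated 3} (x : X.obj (op n)) :
    (unitSimplex x).map (lift φ) = imageSimplex φ x :=
  MorSimplex.ext_tri fun _ _ _ h h' => mor_lift_tri φ x h h'

/-- A simplex and its faces and degeneracies contribute separate generators; they are identified
because every map into `Ψ M` is natural. -/
theorem unitSimplex_map {n m : SimplexCategory.Truncated 3} (f : m ⟶ n) (x : X.obj (op n)) :
    unitSimplex (X.map f.op x) = (unitSimplex x).restrict f.hom.toOrderHom :=
  MorSimplex.ext_tri fun _ _ _ h h' => ext_lift fun M φ =>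
    (mor_lift_tri φ (X.map f.op x) h h').trans
      ((congrArg (fun S : MorSimplex (Fin (m.obj.len + 1)) M.carrier => S.tri h h')
        (imageSimplex_map φ f x)).trans (mor_lift_tri φ x _ _).symm)

/-- The free category is generated by edges and triangles: induction on words for objects, on formal
expressions for morphisms. -/
theorem hom_ext {M : Type u} [Category.{u} M] [MonoidalCategory M] [StrictMonoidal M]
    {F G : StrictMonoidalFunctor (FreeMon X) M}
    (h : ∀ (n : SimplexCategory.Truncated 3) (x : X.obj (op n)),
      (unitSimplex x).map F = (unitSimplex x).map G) : F = G := by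
  have ho : ∀ a, F.obj a = G.obj a := fun a => by
    induction a using Quotient.inductionOn with | _ w
    induction w with
    | nil => exact F.obj_unit.trans G.obj_unit.symm
    | cons e w ih =>
      refine (F.obj_tensor (edge e.simplex e.le) (Quotient.mk _ w)).trans
        (Eq.trans ?_ (G.obj_tensor (edge e.simplex e.le) (Quotient.mk _ w)).symm)
      exact congrArg₂ (fun a b => a ⊗ b)
        (congrArg (fun S : MorSimplex _ M => S.edge e.le) (h _ e.simplex)) ih
  have hp : ∀ {a b : FreeMon X} (f : PreHom a b), F.mor ⟨f.toHom⟩ = G.mor ⟨f.toHom⟩ :=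
    fun {a b} f => by
    induction f with
    | id a =>
      exact (F.mor_id a).trans ((congrArg Mor.id (ho a)).trans (G.mor_id a).symm)
    | comp f g ih ih' =>
      have : Mor.mk (f.comp g).toHom = (Mor.mk f.toHom).comp (Mor.mk g.toHom) :=
        Mor.mk_comp f.toHom g.toHom
      rw [this, F.mor_comp rfl, G.mor_comp rfl, ih, ih']
    | tensor f g ih ih' =>
      refine (F.mor_mul ⟨f.toHom⟩ ⟨g.toHom⟩).trans
        (Eq.trans ?_ (G.mor_mul ⟨f.toHom⟩ ⟨g.toHom⟩).symm)
      rw [ih, ih']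
    | tri x p q => exact congrArg (fun S : MorSimplex _ M => S.tri p q) (h _ x)
  refine StrictMonoidalFunctor.ext_mor fun f => ?_
  obtain ⟨f⟩ := f
  induction f using Quotient.inductionOn with | _ f
  exact hp f

end FreeMon

/-- The free strict monoidal category on a truncated simplicial set. -/
def freeMon (X : SSet.Truncated.{u} 3) : StrMonCat.{u} := ⟨FreeMon X⟩

/-- The universal map into some `Ψ M`. -/
def freeMonUnit (X : SSet.Truncated.{u} 3) : X ⟶ Psi.obj (freeMon X) where
  app n := TypeCat.ofHom fun x =>
    (nerveEquiv (freeMon X) (op n.unop.obj)).symm (FreeMon.unitSimplex x)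
  naturality n m f := by
    ext x
    apply (nerveEquiv (freeMon X) (op m.unop.obj)).injective
    refine ((nerveEquiv _ _).apply_symm_apply _).trans ?_
    refine (FreeMon.unitSimplex_map f.unop x).trans (Eq.symm ?_)
    refine (nerveEquiv_map f.unop.hom.op _).trans ?_
    exact congrArg (MorSimplex.restrict f.unop.hom.toOrderHom)
      ((nerveEquiv (freeMon X) (op n.unop.obj)).apply_symm_apply (FreeMon.unitSimplex x))

theorem imageSimplex_freeMonUnit {n : SimplexCategory.Truncated 3} (x : X.obj (op n)) :
    imageSimplex (freeMonUnit X) x = FreeMon.unitSimplex x :=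
  (nerveEquiv (freeMon X) (op n.obj)).apply_symm_apply (FreeMon.unitSimplex x)

/-- The universal property of the free strict monoidal category on a truncated simplicial set. -/
noncomputable def freeMonEquiv (X : SSet.Truncated.{u} 3) (M : StrMonCat.{u}) :
    (freeMon X ⟶ M) ≃ (X ⟶ Psi.obj M) where
  toFun F := freeMonUnit X ≫ Psi.map F
  invFun φ := FreeMon.lift φ
  left_inv F := FreeMon.hom_ext fun n x => by
    refine (FreeMon.unitSimplex_lift _ x).trans ?_
    rw [imageSimplex_comp, imageSimplex_freeMonUnit]
    rfl
  right_inv φ := hom_ext_imageSimplex fun n x => by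
    refine (imageSimplex_comp (freeMonUnit X) (FreeMon.lift φ) x).trans ?_
    rw [imageSimplex_freeMonUnit]
    exact FreeMon.unitSimplex_lift φ x

theorem freeMonEquiv_comp (X : SSet.Truncated.{u} 3) (M N : StrMonCat.{u}) (F : M ⟶ N)
    (G : freeMon X ⟶ M) :
    freeMonEquiv X N (G ≫ F) = freeMonEquiv X M G ≫ Psi.map F := by
  change freeMonUnit X ≫ Psi.map (G ≫ F) = (freeMonUnit X ≫ Psi.map G) ≫ Psi.map F
  rw [Functor.map_comp, Category.assoc]

/-- The left adjoint `Φ` of `Ψ`. -/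
noncomputable def Phi : SSet.Truncated.{u} 3 ⥤ StrMonCat.{u} :=
  Adjunction.leftAdjointOfEquiv (G := Psi) (F_obj := freeMon) freeMonEquiv
    freeMonEquiv_comp

/-- The adjunction between `Φ` and `Ψ`. -/
noncomputable def phiAdjunction : Phi.{u} ⊣ Psi :=
  Adjunction.adjunctionOfEquivLeft freeMonEquiv freeMonEquiv_comp

end FreeMon

/-! ### The three adjunctions and the left Kan extension -/

section Adjunctions

open Opposite

/-- Maps into the nerve of `BM` are the same as maps of 3-truncations. -/
def truncationEquiv (G : SSet.{u}) (M : StrMonCat.{u}) :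
    (G ⟶ nerveDeloop.obj M) ≃ ((SSet.truncation 3).obj G ⟶ Psi.obj M) where
  toFun α := (SSet.truncation 3).map α
  invFun φ := extendTruncation φ
  left_inv _ := truncation_hom_ext (truncation_extendTruncation _)
  right_inv φ := truncation_extendTruncation φ

/-- The adjunction between `Φ tr₃` and the nerve of `BM`. -/
noncomputable def nerveAdjunction : SSet.truncation.{u} 3 ⋙ Phi ⊣ nerveDeloop.{u} :=
  Adjunction.mkOfHomEquiv
    { homEquiv := fun X M =>
        (phiAdjunction.homEquiv ((SSet.truncation 3).obj X) M).trans (truncationEquiv X M).symm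
      homEquiv_naturality_left_symm := fun {X' X M} f g => by
        refine (congrArg (phiAdjunction.homEquiv _ M).symm
          ((SSet.truncation 3).map_comp f g)).trans ?_
        exact phiAdjunction.homEquiv_naturality_left_symm ((SSet.truncation 3).map f)
          ((SSet.truncation 3).map g)
      homEquiv_naturality_right := fun {X M N} f g => by
        -- After truncation this is naturality of the adjunction between `Φ` and `Ψ`.
        apply (truncationEquiv X N).injective
        refine ((truncationEquiv X N).apply_symm_apply _).trans ?_
        refine (phiAdjunction.homEquiv_naturality_right f g).trans (Eq.symm ?_)
        refine ((SSet.truncation 3).map_comp _ (nerveDeloop.map g)).trans ?_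
        exact congrArg (· ≫ Psi.map g) ((truncationEquiv X M).apply_symm_apply _) }

/-- The adjunction between `(X, C) ↦ Φ tr₃ X` and the operadic Grothendieck construction. -/
noncomputable def integralAdjunction :
    UOpCat.toSSet.{u} ⋙ SSet.truncation.{u} 3 ⋙ Phi ⊣ integral.{u} :=
  -- The forgetful functor to simplicial sets is fully faithful, and it sends the values of
  -- `integral` to nerves, so the adjunction restricts along it.
  nerveAdjunction.restrictFullyFaithful (fullyFaithfulInducedFunctor _)
    (Functor.FullyFaithful.id _) (Iso.refl _) (Iso.refl nerveDeloop)

/-- The generating simplex of `Φ(Δ[n])`. -/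
noncomputable def phiSimplex (n : SimplexCategory.Truncated 3) :
    (Psi.{u}.obj (Phi.obj (uliftYoneda.{u}.obj n))).obj (op n) :=
  uliftYonedaEquiv.{u} (phiAdjunction.unit.app (uliftYoneda.{u}.obj n))

/-- The functor `Φ₀[n] ⥤ Φ(Δ[n])` that preserves the generating simplices. -/
noncomputable def phiZeroHom (n : SimplexCategory.Truncated 3) :
    PhiZero.{u}.obj n ⟶ Phi.obj (uliftYoneda.{u}.obj n) :=
  ((bijective_genPsi n _).2 (phiSimplex n)).choose

theorem map_phiZeroHom (n : SimplexCategory.Truncated 3) :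
    (Psi.map (phiZeroHom.{u} n)).app (op n) (genPsi n) = phiSimplex n :=
  ((bijective_genPsi n _).2 (phiSimplex n)).choose_spec

/-- The functor `Φ(Δ[n]) ⥤ Φ₀[n]` that preserves the generating simplices. -/
noncomputable def phiZeroInv (n : SimplexCategory.Truncated 3) :
    Phi.obj (uliftYoneda.{u}.obj n) ⟶ PhiZero.{u}.obj n :=
  (phiAdjunction.homEquiv _ _).symm (uliftYonedaEquiv.{u}.symm (genPsi n))

/-- `Φ(Δ[n])` corepresents `M ↦ (Ψ M)ₙ`: the adjunction followed by Yoneda is evaluation at the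
universal simplex `phiSimplex n`. -/
theorem map_phiSimplex {n : SimplexCategory.Truncated 3} {M : StrMonCat.{u}}
    (F : Phi.obj (uliftYoneda.{u}.obj n) ⟶ M) :
    (Psi.map F).app (op n) (phiSimplex n) =
      uliftYonedaEquiv.{u} (phiAdjunction.homEquiv _ _ F) := by
  rw [Adjunction.homEquiv_unit, uliftYonedaEquiv_comp]
  rfl

theorem psi_map_comp_app {n : SimplexCategory.Truncated 3} {M N P : StrMonCat.{u}} (F : M ⟶ N)
    (G : N ⟶ P) (x : (Psi.obj M).obj (op n)) :
    (Psi.map (F ≫ G)).app (op n) x = (Psi.map G).app (op n) ((Psi.map F).app (op n) x) := by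
  rw [Functor.map_comp]
  rfl

/-- `Φ` extends `Φ₀`. -/
noncomputable def phiZeroIso : PhiZero.{u} ≅ uliftYoneda.{u} ⋙ Phi :=
  NatIso.ofComponents
    (fun n =>
      { hom := phiZeroHom n
        inv := phiZeroInv n
        hom_inv_id := by
          -- An endomorphism of `Φ₀[n]` that fixes the generating simplex is the identity; the next
          -- field is the same argument for `Φ(Δ[n])` and `phiSimplex n`.
          apply (bijective_genPsi n _).1
          refine (psi_map_comp_app _ _ _).trans ?_
          rw [map_phiZeroHom, map_phiSimplex, phiZeroInv, Equiv.apply_symm_apply,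
            Equiv.apply_symm_apply]
          simp
        inv_hom_id := by
          apply (phiAdjunction.homEquiv _ _).injective
          apply uliftYonedaEquiv.{u}.injective
          rw [← map_phiSimplex, ← map_phiSimplex, psi_map_comp_app, map_phiSimplex, phiZeroInv,
            Equiv.apply_symm_apply, Equiv.apply_symm_apply]
          refine (map_phiZeroHom n).trans ?_
          simp })
    (fun {n m} f => by
      -- Both composites start at `Φ₀[n]`, so they are compared on the generating simplex, where
      -- naturality of the unit of the adjunction applies.
      apply (bijective_genPsi n _).1
      refine (psi_map_comp_app _ _ _).trans (Eq.trans ?_ (psi_map_comp_app _ _ _).symm)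
      dsimp only
      rw [map_phiZeroHom, map_genPsi, NatTrans.naturality_apply, map_phiZeroHom]
      have h := uliftYonedaEquiv_naturality.{u} (X := op m) (Y := op n)
        (phiAdjunction.unit.app (uliftYoneda.{u}.obj m)) f.op
      refine h.trans ?_
      refine (congrArg uliftYonedaEquiv.{u}
        (phiAdjunction.unit.naturality (uliftYoneda.{u}.map f))).trans ?_
      rfl)

instance isLeftKanExtension_phi : Phi.{u}.IsLeftKanExtension phiZeroIso.{u}.hom := by
  -- The index categories are categories of elements: objects in universe `u`, morphisms in universe
  -- `0`.
  have : Limits.PreservesColimitsOfSize.{0, u} Phi.{u} :=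
    phiAdjunction.leftAdjoint_preservesColimits
  -- Density: the identity is the left Kan extension of the Yoneda embedding along itself, and `Φ`
  -- preserves it. It remains to replace `Φ ∘ y` by the isomorphic `Φ₀`.
  have h : (𝟭 (SSet.Truncated.{u} 3) ⋙ Phi).IsLeftKanExtension
      (Functor.whiskerRight (Functor.rightUnitor (uliftYoneda.{u})).inv Phi ≫
        (Functor.associator _ _ _).hom) :=
    Functor.PreservesLeftKanExtension.preserves _ _
  refine (Functor.isLeftKanExtension_iff_of_iso₂ _ _ phiZeroIso.{u}.symm
    (Functor.leftUnitor Phi) ?_).1 h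
  ext n : 2
  simp

end Adjunctions

end UnaryOperadic

theorem mainTheorem2 :
    -- the strict monoidal category `Φ₀[n]` is freely generated by its generating `n`-simplex
    (∀ (n : SimplexCategory.Truncated 3) (M : UnaryOperadic.StrMonCat.{u}),
      Function.Bijective fun F : UnaryOperadic.PhiZero.{u}.obj n ⟶ M =>
        (UnaryOperadic.Psi.map F).app (Opposite.op n) (UnaryOperadic.genPsi n)) ∧
    -- `Φ₀ f` is the functor that is determined by the simplex `σ ∘ f`
    (∀ (n m : SimplexCategory.Truncated 3) (f : n ⟶ m),
      (UnaryOperadic.Psi.map (UnaryOperadic.PhiZero.{u}.map f)).app (Opposite.op n)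
          (UnaryOperadic.genPsi n) =
        (UnaryOperadic.Psi.obj (UnaryOperadic.PhiZero.obj m)).map f.op (UnaryOperadic.genPsi m)) ∧
    -- the nerve of `BM` is 3-coskeletal
    (∀ M : UnaryOperadic.StrMonCat.{u},
      (UnaryOperadic.nerveDeloop.obj M).IsCoskeletal 3) ∧
    -- `Φ = Lan_y Φ₀` exists and is left adjoint to `Ψ`, and `Φ tr₃` is left adjoint to the nerve
    -- `M ↦ N(BM)` and to the operadic Grothendieck construction
    ∃ (Φ : SSet.Truncated.{u} 3 ⥤ UnaryOperadic.StrMonCat.{u})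
      (η : UnaryOperadic.PhiZero.{u} ⟶ uliftYoneda.{u} ⋙ Φ),
      Φ.IsLeftKanExtension η ∧
      Nonempty (Φ ⊣ UnaryOperadic.Psi.{u}) ∧
      Nonempty (SSet.truncation.{u} 3 ⋙ Φ ⊣ UnaryOperadic.nerveDeloop.{u}) ∧
      Nonempty (UnaryOperadic.UOpCat.toSSet.{u} ⋙ SSet.truncation.{u} 3 ⋙ Φ ⊣
        UnaryOperadic.integral.{u}) :=
  ⟨UnaryOperadic.bijective_genPsi, fun _ _ f => UnaryOperadic.map_genPsi f,
    UnaryOperadic.isCoskeletal_nerveDeloop, UnaryOperadic.Phi, UnaryOperadic.phiZeroIso.hom,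
    inferInstance, ⟨UnaryOperadic.phiAdjunction⟩, ⟨UnaryOperadic.nerveAdjunction⟩,
    ⟨UnaryOperadic.integralAdjunction⟩⟩
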